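/- Let $d\ge 1$ and let $\Omega\subset\mathbb R^d$ be a bounded, open, connected set with $C^1$ boundary $\Gamma=\partial\Omega$ and outward unit normal $\nu$. Let $\Gamma_D,\Gamma_N\subset\Gamma$ be disjoint and relatively open in $\Gamma$, with $\Gamma=\overline{\Gamma}_D\cup\overline{\Gamma}_N$ and $\overline{\Gamma}_D\cap\overline{\Gamma}_N$ of zero $(d-1)$-dimensional surface measure. Let $\alpha,\beta>1$, $C>0$, $z_0\in\mathbb R$, $\gamma=\alpha\beta$ and $\beta'=\beta/(\beta-1)$. Let $j\in L^{\beta'}(\Gamma_N)$ with $j\ge 0$, and let $\psi\in C(\overline\Omega)\cap W^{1,\gamma}(\Omega)$. Then there is a constant $C_0>0$, depending only on $\Omega,\Gamma_D,\Gamma_N,\alpha,\beta,C,z_0,j,\psi$, with the following property. Let $g\in C^1([0,\infty))$ be non-negative and non-decreasing with $$\frac{z^{1/(\alpha-1)}}{C}\le g(z)\le C\bigl(z^{1/(\alpha-1)}+1\bigr)\qquad\text{for all } z\ge 0 \text{ with } z\ge z_0 .$$ Let $H\in C^2(\overline\Omega\times\mathbb R^d)$ be bounded from below, with $p\mapsto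 H(x,p)$ strictly convex for every $x\in\Omega$, such that for all $(x,p)\in\Omega\times\mathbb R^d$ $$\frac{|p|^\beta}{C}-C\le H(x,p)\le C(|p|^\beta+1),\qquad |D_xH(x,p)|\le C(|p|^\beta+1),\qquad |D_pH(x,p)|\le C(|p|^{\beta-1}+1),$$ $$-H(x,p)+D_pH(x,p)\cdot p\ \ge\ \frac{|p|^\beta}{C}-C .$$ Let $(m,u)$ be a classical solution of the mean-field game, that is, $m\in C^1(\Omega)\cap C(\overline\Omega)$, $m\ge0$, $u\in C^2(\Omega)\cap C^1(\overline\Omega)$, $$H(x,Du)=g(m)\quad\text{and}\quad -\operatorname{div}\bigl(m\,D_pH(x,Du)\bigr)=0\qquad\text{in }\Omega,$$ and, almost everywhere with respect to surface measure, $$m\,D_pH(x,Du)\cdot\nu=j\ \text{ on }\Gamma_N,\qquad m\,D_pH(x,Du)\cdot\nu\le 0,\quad u\le\psi,\quad (\psi-u)\,m\,D_pH(x,Du)\cdot\nu=0\ \text{ on }\Gamma_D .$$ Then $m\,g(m)+\frac1C(m+1)|Du|^\beta$ is integrable on $\Omega$ and $$\int_\Omega \Bigl[m\,g(m)+\frac{(m+1)|Du|^\beta}{C}\Bigr]\,dx\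 \le\ C_0 .$$ -/

import Mathlib

open MeasureTheory Set
open scoped ENNReal Gradient ContDiff

noncomputable section

namespace MFG

/-- The Euclidean space `ℝ^d`. -/
abbrev Space (d : ℕ) : Type := EuclideanSpace ℝ (Fin d)

/-- The `(d-1)`-dimensional surface measure on subsets of `ℝ^d` (used for `1 ≤ d`): the Hausdorff
measure of dimension `d - 1`, normalized to agree with Lebesgue measure on hyperplanes. -/
def surfaceMeasure (d : ℕ) : Measure (Space d) := μHE[d - 1]

/-- For a unit vector `e`, the function `x ↦ x_e - φ (x')`, where `x_e = ⟨e, x⟩` and `x' = x - x_e e`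
is the orthogonal projection of `x` to the hyperplane `e^⊥`. -/
def graphFun {d : ℕ} (e : Space d) (φ : Space d → ℝ) (x : Space d) : ℝ :=
  inner ℝ e x - φ (x - (inner ℝ e x : ℝ) • e)

/-- In the open neighbourhood `U` of `x₀`, the set `Ω` is the region strictly below the graph of a
`C^1` function over the hyperplane orthogonal to the unit vector `e`. -/
structure IsGraphChart {d : ℕ} (Ω : Set (Space d)) (x₀ : Space d) (U : Set (Space d))
    (e : Space d) (φ : Space d → ℝ) : Prop where
  norm_eq_one : ‖e‖ = 1
  contDiff : ContDiff ℝ 1 φ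
  isOpen : IsOpen U
  mem : x₀ ∈ U
  mem_iff : ∀ x ∈ U, x ∈ Ω ↔ graphFun e φ x < 0

/-- A bounded, open, connected (nonempty) set with `C^1` boundary. -/
structure IsC1Domain {d : ℕ} (Ω : Set (Space d)) : Prop where
  isOpen : IsOpen Ω
  isConnected : IsConnected Ω
  isBounded : Bornology.IsBounded Ω
  exists_chart : ∀ x₀ ∈ frontier Ω, ∃ U e φ, IsGraphChart Ω x₀ U e φ

/-- `ν` is the outward unit normal to `Ω` at the boundary point `x`: the normalized gradient of the
local defining function of a graph chart. -/
def IsOutwardNormal {d : ℕ} (Ω : Set (Space d)) (x ν : Space d) : Prop :=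
  ∃ U e φ, IsGraphChart Ω x U e φ ∧ ν = ‖∇ (graphFun e φ) x‖⁻¹ • ∇ (graphFun e φ) x

/-- The boundary of `Ω` is split into the disjoint, relatively open parts `ΓD` and `ΓN`, up to the
common boundary of these, which has surface measure zero. -/
structure IsBoundaryPartition {d : ℕ} (Ω ΓD ΓN : Set (Space d)) : Prop where
  relOpen_D : ∃ U, IsOpen U ∧ ΓD = U ∩ frontier Ω
  relOpen_N : ∃ U, IsOpen U ∧ ΓN = U ∩ frontier Ω
  disjoint : Disjoint ΓD ΓN
  cover : frontier Ω = closure ΓD ∪ closure ΓN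
  null_inter : surfaceMeasure d (closure ΓD ∩ closure ΓN) = 0

/-- `W` is the weak gradient of `f` on `Ω`. -/
def IsWeakGradient {d : ℕ} (Ω : Set (Space d)) (f : Space d → ℝ) (W : Space d → Space d) : Prop :=
  ∀ η : Space d → ℝ, ContDiff ℝ ∞ η → HasCompactSupport η → tsupport η ⊆ Ω →
    ∀ i : Fin d, ∫ x in Ω, f x * fderiv ℝ η x (EuclideanSpace.single i 1)
      = - ∫ x in Ω, W x i * η x

/-- `f ∈ W^{1,p}(Ω)`. -/
def MemW1 {d : ℕ} (Ω : Set (Space d)) (p : ℝ) (f : Space d → ℝ) : Prop :=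
  MemLp f (ENNReal.ofReal p) (volume.restrict Ω) ∧
    ∃ W : Space d → Space d, MemLp W (ENNReal.ofReal p) (volume.restrict Ω) ∧ IsWeakGradient Ω f W

/-- The divergence `∑ i, ∂_i F_i` of a vector field. -/
def divergence {d : ℕ} (F : Space d → Space d) (x : Space d) : ℝ :=
  ∑ i : Fin d, fderiv ℝ F x (EuclideanSpace.single i 1) i

/-- The assumptions on the coupling `g : [0, ∞) → ℝ`, with exponent `α`, constant `C`, and growth
bounds for arguments `z ≥ z₀`. -/
structure CouplingAssumption (α C z₀ : ℝ) (g : ℝ → ℝ) : Prop where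
  contDiffOn : ContDiffOn ℝ 1 g (Ici 0)
  nonneg : ∀ z, 0 ≤ z → 0 ≤ g z
  monotoneOn : MonotoneOn g (Ici 0)
  lower : ∀ z, 0 ≤ z → z₀ ≤ z → z ^ (1 / (α - 1)) / C ≤ g z
  upper : ∀ z, 0 ≤ z → z₀ ≤ z → g z ≤ C * (z ^ (1 / (α - 1)) + 1)

/-- The assumptions on the Hamiltonian `H : closure Ω × ℝ^d → ℝ`, with exponent `β` and constant
`C`. Here `∇ (H x) p` is `D_p H (x, p)`. -/
structure HamiltonianAssumption {d : ℕ} (Ω : Set (Space d)) (β C : ℝ)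
    (H : Space d → Space d → ℝ) : Prop where
  contDiffOn : ContDiffOn ℝ 2 (fun q : Space d × Space d => H q.1 q.2) (closure Ω ×ˢ univ)
  bddBelow : ∃ b : ℝ, ∀ x ∈ closure Ω, ∀ p, b ≤ H x p
  strictConvexOn : ∀ x ∈ Ω, StrictConvexOn ℝ univ (H x)
  lower : ∀ x ∈ Ω, ∀ p, ‖p‖ ^ β / C - C ≤ H x p
  upper : ∀ x ∈ Ω, ∀ p, H x p ≤ C * (‖p‖ ^ β + 1)
  bound_Dx : ∀ x ∈ Ω, ∀ p, ‖∇ (fun y => H y p) x‖ ≤ C * (‖p‖ ^ β + 1)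
  bound_Dp : ∀ x ∈ Ω, ∀ p, ‖∇ (H x) p‖ ≤ C * (‖p‖ ^ (β - 1) + 1)
  lagrangian_lower : ∀ x ∈ Ω, ∀ p, ‖p‖ ^ β / C - C ≤ - H x p + inner ℝ (∇ (H x) p) p

/-- The boundary conditions, for `m`, `u` and the boundary values `P` of the gradient of `u`; they
are required almost everywhere for the surface measure. -/
structure BoundaryConditions {d : ℕ} (Ω ΓD ΓN : Set (Space d)) (H : Space d → Space d → ℝ)
    (j ψ m u : Space d → ℝ) (P : Space d → Space d) : Prop where
  neumann : ∀ᵐ x ∂(surfaceMeasure d).restrict ΓN, ∀ ν, IsOutwardNormal Ω x ν →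
    m x * inner ℝ (∇ (H x) (P x)) ν = j x
  outflow : ∀ᵐ x ∂(surfaceMeasure d).restrict ΓD, ∀ ν, IsOutwardNormal Ω x ν →
    m x * inner ℝ (∇ (H x) (P x)) ν ≤ 0
  exit_cost : ∀ᵐ x ∂(surfaceMeasure d).restrict ΓD, u x ≤ ψ x
  contact : ∀ᵐ x ∂(surfaceMeasure d).restrict ΓD, ∀ ν, IsOutwardNormal Ω x ν →
    (ψ x - u x) * (m x * inner ℝ (∇ (H x) (P x)) ν) = 0

/-- `(m, u)` is a classical solution of the mean-field game: `m ∈ C^1(Ω) ∩ C(closure Ω)`, `m ≥ 0`,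
`u ∈ C^2(Ω) ∩ C^1(closure Ω)`, both equations hold at every point of `Ω`, and the boundary
conditions hold. The function `P` is the continuous extension of `Du` to `closure Ω`. -/
structure IsClassicalSolution {d : ℕ} (Ω ΓD ΓN : Set (Space d)) (g : ℝ → ℝ)
    (H : Space d → Space d → ℝ) (j ψ m u : Space d → ℝ) : Prop where
  contDiffOn_m : ContDiffOn ℝ 1 m Ω
  continuousOn_m : ContinuousOn m (closure Ω)
  nonneg_m : ∀ x ∈ Ω, 0 ≤ m x
  contDiffOn_u : ContDiffOn ℝ 2 u Ω
  continuousOn_u : ContinuousOn u (closure Ω)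
  hamiltonJacobi : ∀ x ∈ Ω, H x (∇ u x) = g (m x)
  transport : ∀ x ∈ Ω, - divergence (fun y => m y • ∇ (H y) (∇ u y)) x = 0
  boundary : ∃ P : Space d → Space d, ContinuousOn P (closure Ω) ∧ (∀ x ∈ Ω, P x = ∇ u x) ∧
    BoundaryConditions Ω ΓD ΓN H j ψ m u P

end MFG

end

noncomputable section

namespace MFG

open Filter Topology

/-! Let F = m D_pH(x, Du) be the flux of the given solution and G the flux of one fixed solution for
the same data, with some admissible g and H; if no solution exists, there is nothing to prove. The
field F - G is solenoidal, and testing it with u - ψ gives ∫ (F - G)·(Du - Dψ) ≤ 0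
(`IsFlux.integral_inner_sub_le_zero`): on ΓN the normal fluxes agree, and on ΓD the contact
condition removes F, while u - ψ and G·ν are both nonpositive. Since G is chosen before g, H and (m,
u), its supremum is an admissible constant.

The Hamilton-Jacobi equation and the lower bound on D_pH·p - H give F·Du ≥ m|Du|^β/C + m g(m) - C m.
By the growth of g, m g(m) controls m^{α/(α-1)}; as |Du|^β/C - C ≤ g(m) ≤ m g(m) + const, it also
controls |Du|^β. Young's inequality absorbs all other terms, at the price of |Dψ|^{αβ}
(`exists_pointwise_bound`).

The sign of the boundary term is exploited without traces or surface integrals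
(`IsGraphChart.integral_le_zero`): cutoffs along the levels of a chart function have gradients that
concentrate at the boundary with bounded mass. This needs the sign at every boundary point. The
conditions hold only almost everywhere, but surface measure charges every nonempty relatively open
part of the boundary (`IsGraphChart.surfaceMeasure_ne_zero`), so continuity gives the rest. -/

/-! ### Weak gradients tested with `C^1` functions. -/

/-- A `C^1` function with compact support in an open set is approximated in the `C^1` norm by smooth
functions with compact support in that set. -/
theorem exists_contDiff_approx {E : Type*} [NormedAddCommGroup E] [InnerProductSpace ℝ E]
    [FiniteDimensional ℝ E] [MeasurableSpace E] [BorelSpace E] {Ω : Set E} (hΩ : IsOpen Ω)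
    {η : E → ℝ} (hη : ContDiff ℝ 1 η) (hc : HasCompactSupport η) (hs : tsupport η ⊆ Ω)
    {ε : ℝ} (hε : 0 < ε) :
    ∃ η' : E → ℝ, ContDiff ℝ ∞ η' ∧ HasCompactSupport η' ∧ tsupport η' ⊆ Ω ∧
      (∀ x, |η' x - η x| ≤ ε) ∧ ∀ x, ‖fderiv ℝ η' x - fderiv ℝ η x‖ ≤ ε := by
  have hη' : Continuous (fderiv ℝ η) := hη.continuous_fderiv one_ne_zero
  have hu : UniformContinuous η :=
    hη.continuous.uniformContinuous_of_tendsto_cocompact hc.is_zero_at_infty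
  have hu' : UniformContinuous (fderiv ℝ η) :=
    hη'.uniformContinuous_of_tendsto_cocompact (hc.fderiv ℝ).is_zero_at_infty
  obtain ⟨r₁, hr₁, h₁⟩ := Metric.uniformContinuous_iff.1 hu ε hε
  obtain ⟨r₂, hr₂, h₂⟩ := Metric.uniformContinuous_iff.1 hu' ε hε
  obtain ⟨r₃, hr₃, h₃⟩ := IsCompact.exists_cthickening_subset_open hc hΩ hs
  -- The mollification radius: `r₁` and `r₂` are moduli of continuity of `η` and of its derivative,
  -- and `r₃` keeps the support inside `Ω`.
  have hr : 0 < min r₁ (min r₂ r₃) := by positivity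
  let φ : ContDiffBump (0 : E) :=
    ⟨min r₁ (min r₂ r₃) / 2, min r₁ (min r₂ r₃), by linarith, by linarith⟩
  have hout : φ.rOut = min r₁ (min r₂ r₃) := rfl
  have hli : LocallyIntegrable (φ.normed volume) (volume : Measure E) :=
    φ.continuous_normed.locallyIntegrable
  have hsub : Function.support
      (convolution (φ.normed volume) η (ContinuousLinearMap.lsmul ℝ ℝ) volume) ⊆
      Metric.cthickening r₃ (tsupport η) := by
    refine (support_convolution_subset (L := ContinuousLinearMap.lsmul ℝ ℝ)).trans ?_
    rintro _ ⟨a, ha, b, hb, rfl⟩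
    rw [φ.support_normed_eq, mem_ball_zero_iff, hout] at ha
    refine Metric.mem_cthickening_of_dist_le _ b _ _ (subset_tsupport _ hb) ?_
    rw [dist_eq_norm]
    simpa using (ha.le.trans ((min_le_right _ _).trans (min_le_right _ _)))
  refine ⟨convolution (φ.normed volume) η (ContinuousLinearMap.lsmul ℝ ℝ) volume, ?_, ?_, ?_,
    ?_, ?_⟩
  · exact φ.hasCompactSupport_normed.contDiff_convolution_left _ φ.contDiff_normed
      hη.continuous.locallyIntegrable
  · exact HasCompactSupport.of_support_subset_isCompact (IsCompact.cthickening hc) hsub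
  · exact (closure_minimal hsub Metric.isClosed_cthickening).trans h₃
  · intro x
    rw [← Real.dist_eq]
    refine φ.dist_normed_convolution_le hη.continuous.aestronglyMeasurable fun y hy => ?_
    exact (h₁ (lt_of_lt_of_le hy (min_le_left _ _))).le
  · intro x
    have hd := (hc.hasFDerivAt_convolution_right (ContinuousLinearMap.lsmul ℝ ℝ) hli hη x).fderiv
    have he : convolution (φ.normed volume) (fderiv ℝ η)
          (ContinuousLinearMap.precompR E (ContinuousLinearMap.lsmul ℝ ℝ)) volume x
        = convolution (φ.normed volume) (fderiv ℝ η) (ContinuousLinearMap.lsmul ℝ ℝ) volume x := by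
      simp only [convolution]
      congr 1
    rw [hd, he, ← dist_eq_norm]
    refine φ.dist_normed_convolution_le hη'.aestronglyMeasurable fun y hy => ?_
    exact (h₂ (lt_of_lt_of_le hy ((min_le_right _ _).trans (min_le_left _ _)))).le

theorem integrable_mul_of_hasCompactSupport {X : Type*} [TopologicalSpace X] [MeasurableSpace X]
    [OpensMeasurableSpace X] {μ : Measure X} {f g : X → ℝ} (hf : Integrable f μ)
    (hg : Continuous g) (hc : HasCompactSupport g) : Integrable (fun x => f x * g x) μ := by
  obtain ⟨K, hK⟩ := hc.exists_bound_of_continuous hg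
  exact hf.mul_bdd hg.aestronglyMeasurable (ae_of_all _ hK)

/-- Approximation in the `C^1` norm extends the definition from smooth test functions. This is
needed because the test functions used later have the components of a `C^1` flux as factors. -/
theorem IsWeakGradient.integral_mul_fderiv {d : ℕ} {Ω : Set (Space d)} (hΩ : IsOpen Ω)
    {f : Space d → ℝ} {W : Space d → Space d} (h : IsWeakGradient Ω f W)
    (hf : IntegrableOn f Ω) (hW : IntegrableOn W Ω) {η : Space d → ℝ} (hη : ContDiff ℝ 1 η)
    (hc : HasCompactSupport η) (hs : tsupport η ⊆ Ω) (i : Fin d) :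
    ∫ x in Ω, f x * fderiv ℝ η x (EuclideanSpace.single i 1) = - ∫ x in Ω, W x i * η x := by
  have hWi : IntegrableOn (fun x => W x i) Ω :=
    (EuclideanSpace.proj (𝕜 := ℝ) i).integrable_comp hW
  have int_f {θ : Space d → ℝ} (h1 : ContDiff ℝ 1 θ) (h2 : HasCompactSupport θ) :
      IntegrableOn (fun x => f x * fderiv ℝ θ x (EuclideanSpace.single i 1)) Ω :=
    integrable_mul_of_hasCompactSupport hf
      ((h1.continuous_fderiv one_ne_zero).clm_apply continuous_const)
      (h2.fderiv_apply ℝ _)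
  have int_W {θ : Space d → ℝ} (h1 : ContDiff ℝ 1 θ) (h2 : HasCompactSupport θ) :
      IntegrableOn (fun x => W x i * θ x) Ω :=
    integrable_mul_of_hasCompactSupport hWi h1.continuous h2
  rw [← add_eq_zero_iff_eq_neg]
  set S : ℝ := (∫ x in Ω, |f x|) + ∫ x in Ω, |W x i| with hS
  have hS0 : 0 ≤ S := add_nonneg (integral_nonneg fun _ => abs_nonneg _)
    (integral_nonneg fun _ => abs_nonneg _)
  have key : ∀ ε > 0, |(∫ x in Ω, f x * fderiv ℝ η x (EuclideanSpace.single i 1)) +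
      ∫ x in Ω, W x i * η x| ≤ ε * S := by
    intro ε hε
    obtain ⟨θ, hθ, hθc, hθs, h0, h1⟩ := exists_contDiff_approx hΩ hη hc hs hε
    have hθ1 : ContDiff ℝ 1 θ := hθ.of_le (by exact_mod_cast le_top)
    have e := h θ hθ hθc hθs i
    have e1 : (∫ x in Ω, f x * fderiv ℝ η x (EuclideanSpace.single i 1)) +
        ∫ x in Ω, W x i * η x =
        (∫ x in Ω, (f x * fderiv ℝ η x (EuclideanSpace.single i 1) -
          f x * fderiv ℝ θ x (EuclideanSpace.single i 1))) +
        ∫ x in Ω, (W x i * η x - W x i * θ x) := by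
      rw [integral_sub (int_f hη hc) (int_f hθ1 hθc), integral_sub (int_W hη hc) (int_W hθ1 hθc), e]
      ring
    rw [e1, hS, mul_add, ← integral_const_mul, ← integral_const_mul]
    refine (abs_add_le _ _).trans (add_le_add ?_ ?_)
    · rw [← Real.norm_eq_abs]
      refine (norm_integral_le_of_norm_le (g := fun x => ε * |f x|) (hf.abs.const_mul ε)
        (ae_of_all _ fun x => ?_))
      rw [← mul_sub, norm_mul, mul_comm ε, Real.norm_eq_abs (f x)]
      gcongr
      have := (fderiv ℝ η x - fderiv ℝ θ x).le_opNorm (EuclideanSpace.single i 1)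
      rw [norm_sub_rev] at this
      simpa using this.trans (mul_le_mul_of_nonneg_right (h1 x) (norm_nonneg _))
    · rw [← Real.norm_eq_abs]
      refine (norm_integral_le_of_norm_le (g := fun x => ε * |W x i|) (hWi.abs.const_mul ε)
        (ae_of_all _ fun x => ?_))
      rw [← mul_sub, norm_mul, mul_comm ε, Real.norm_eq_abs (W x i), norm_sub_rev]
      gcongr
      exact h0 x
  rw [← abs_nonpos_iff]
  refine le_of_forall_pos_le_add fun ε hε => ?_
  refine (key (ε / (S + 1)) (by positivity)).trans ?_
  rw [zero_add, div_mul_eq_mul_div, div_le_iff₀ (by positivity)]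
  nlinarith

theorem contDiff_mul_of_tsupport_subset {E : Type*} [NormedAddCommGroup E] [NormedSpace ℝ E]
    {Ω : Set E} (hΩ : IsOpen Ω) {n : WithTop ℕ∞} {f g : E → ℝ} (hf : ContDiffOn ℝ n f Ω)
    (hg : ContDiff ℝ n g) (hs : tsupport g ⊆ Ω) : ContDiff ℝ n (fun x => f x * g x) := by
  refine contDiff_iff_contDiffAt.2 fun x => ?_
  by_cases hx : x ∈ tsupport g
  · exact (hf.contDiffAt (hΩ.mem_nhds (hs hx))).mul hg.contDiffAt
  · refine (contDiffAt_const (c := (0 : ℝ))).congr_of_eventuallyEq ?_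
    filter_upwards [notMem_tsupport_iff_eventuallyEq.1 hx] with y hy
    simp [hy]

/-- Nothing is known of `u` outside `Ω`, but its products with a test function supported in `Ω` are
regular on the whole space, where integration by parts has no boundary term. -/
theorem isWeakGradient_gradient {d : ℕ} {Ω : Set (Space d)} (hΩ : IsOpen Ω) {u : Space d → ℝ}
    (hu : ContDiffOn ℝ 1 u Ω) : IsWeakGradient Ω u (∇ u) := by
  intro η hη hc hs i
  have hη1 : ContDiff ℝ 1 η := hη.of_le (by exact_mod_cast le_top)
  set v : Space d := EuclideanSpace.single i 1 with hv
  have hgi (x : Space d) : (∇ u x) i = fderiv ℝ u x v := by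
    rw [← inner_gradient_left, hv, EuclideanSpace.inner_single_right]
    simp
  have hs' : tsupport (fun x => fderiv ℝ η x v) ⊆ Ω := (tsupport_fderiv_apply_subset ℝ v).trans hs
  have hcu' : ContinuousOn (fun x => fderiv ℝ u x v) Ω :=
    (hu.continuousOn_fderiv_of_isOpen hΩ le_rfl).clm_apply continuousOn_const
  have c1 : Continuous (fun x => u x * fderiv ℝ η x v) :=
    contDiff_zero.1 (contDiff_mul_of_tsupport_subset hΩ (contDiffOn_zero.2 hu.continuousOn)
      (contDiff_zero.2 ((hη1.continuous_fderiv one_ne_zero).clm_apply continuous_const)) hs')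
  have c2 : Continuous (fun x => fderiv ℝ u x v * η x) :=
    contDiff_zero.1 (contDiff_mul_of_tsupport_subset hΩ (contDiffOn_zero.2 hcu')
      (contDiff_zero.2 hη.continuous) hs)
  have c3 : Continuous (fun x => u x * η x) :=
    (contDiff_mul_of_tsupport_subset hΩ hu hη1 hs).continuous
  have hc' : HasCompactSupport (fun x => fderiv ℝ η x v) := hc.fderiv_apply ℝ v
  have e := integral_mul_fderiv_eq_neg_fderiv_mul_of_integrable (μ := volume) (f := u) (g := η)
    (v := v)
    (c2.integrable_of_hasCompactSupport (HasCompactSupport.mul_left hc))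
    (c1.integrable_of_hasCompactSupport (HasCompactSupport.mul_left hc'))
    (c3.integrable_of_hasCompactSupport (HasCompactSupport.mul_left hc))
    (fun x hx => (hu.contDiffAt (hΩ.mem_nhds (hs hx))).differentiableAt one_ne_zero)
    (fun x _ => hη1.differentiable one_ne_zero x)
  simp only [hgi]
  rw [setIntegral_eq_integral_of_forall_compl_eq_zero, setIntegral_eq_integral_of_forall_compl_eq_zero,
    e]
  · intro x hx
    rw [image_eq_zero_of_notMem_tsupport (fun h => hx (hs h)), mul_zero]
  · intro x hx
    rw [image_eq_zero_of_notMem_tsupport (f := fun x => fderiv ℝ η x v) (fun h => hx (hs' h)),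
      mul_zero]

theorem IsWeakGradient.sub {d : ℕ} {Ω : Set (Space d)} {f g : Space d → ℝ}
    {V W : Space d → Space d} (hf : IsWeakGradient Ω f V) (hg : IsWeakGradient Ω g W)
    (hfi : IntegrableOn f Ω) (hgi : IntegrableOn g Ω) (hV : IntegrableOn V Ω)
    (hW : IntegrableOn W Ω) : IsWeakGradient Ω (fun x => f x - g x) (fun x => V x - W x) := by
  intro η hη hc hs i
  have hη1 : ContDiff ℝ 1 η := hη.of_le (by exact_mod_cast le_top)
  have hcomp {Z : Space d → Space d} (hZ : IntegrableOn Z Ω volume) : IntegrableOn (fun x => Z x i) Ω :=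
    (EuclideanSpace.proj (𝕜 := ℝ) i).integrable_comp hZ
  have h1 {f : Space d → ℝ} (hf : IntegrableOn f Ω) :=
    integrable_mul_of_hasCompactSupport hf
      ((hη1.continuous_fderiv one_ne_zero).clm_apply continuous_const)
      (hc.fderiv_apply ℝ (EuclideanSpace.single i 1))
  have h2 {f : Space d → ℝ} (hf : IntegrableOn f Ω) :=
    integrable_mul_of_hasCompactSupport hf hη.continuous hc
  simp only [PiLp.sub_apply, sub_mul]
  rw [integral_sub (h1 hfi) (h1 hgi), integral_sub (h2 (hcomp hV)) (h2 (hcomp hW)),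
    hf η hη hc hs i, hg η hη hc hs i]
  ring

/-- Integration by parts of a solenoidal field against a function with a weak gradient, localized by
a cutoff with compact support. -/
theorem IsWeakGradient.integral_mul_inner {d : ℕ} {Ω : Set (Space d)} (hΩ : IsOpen Ω)
    {f : Space d → ℝ} {W G : Space d → Space d} (h : IsWeakGradient Ω f W)
    (hf : IntegrableOn f Ω) (hW : IntegrableOn W Ω) (hG : ContDiffOn ℝ 1 G Ω)
    (hdiv : ∀ x ∈ Ω, divergence G x = 0) {ξ : Space d → ℝ} (hξ : ContDiff ℝ 1 ξ)
    (hc : HasCompactSupport ξ) (hs : tsupport ξ ⊆ Ω) :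
    ∫ x in Ω, f x * fderiv ℝ ξ x (G x) = - ∫ x in Ω, ξ x * inner ℝ (G x) (W x) := by
  have hGi (i : Fin d) : ContDiffOn ℝ 1 (fun x => G x i) Ω := contDiffOn_euclidean.1 hG i
  have hη (i : Fin d) : ContDiff ℝ 1 (fun x => G x i * ξ x) :=
    contDiff_mul_of_tsupport_subset hΩ (hGi i) hξ hs
  have hηc (i : Fin d) : HasCompactSupport (fun x => G x i * ξ x) := HasCompactSupport.mul_left hc
  have hηs (i : Fin d) : tsupport (fun x => G x i * ξ x) ⊆ Ω :=
    (tsupport_mul_subset_right (f := fun x => G x i)).trans hs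
  -- The divergence of `ξ G` is Dξ·G + ξ div G, and the second term vanishes.
  have hsum (x : Space d) (hx : x ∈ Ω) : fderiv ℝ ξ x (G x) =
      ∑ i, fderiv ℝ (fun y => G y i * ξ y) x (EuclideanSpace.single i 1) := by
    have hGd : DifferentiableAt ℝ G x :=
      (hG.contDiffAt (hΩ.mem_nhds hx)).differentiableAt one_ne_zero
    have hd (i : Fin d) : fderiv ℝ (fun y => G y i * ξ y) x (EuclideanSpace.single i 1) =
        G x i * fderiv ℝ ξ x (EuclideanSpace.single i 1) +
          ξ x * fderiv ℝ G x (EuclideanSpace.single i 1) i := by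
      have h1 : HasFDerivAt (fun y => G y i)
          ((EuclideanSpace.proj (𝕜 := ℝ) i).comp (fderiv ℝ G x)) x :=
        (EuclideanSpace.proj (𝕜 := ℝ) i).hasFDerivAt.comp x hGd.hasFDerivAt
      have h2 := h1.fun_mul (hξ.differentiable one_ne_zero x).hasFDerivAt
      rw [HasFDerivAt.fderiv h2]
      simp
    simp only [hd]
    rw [Finset.sum_add_distrib, ← Finset.mul_sum]
    have h0 : ∑ i, fderiv ℝ G x (EuclideanSpace.single i 1) i = 0 := hdiv x hx
    rw [h0, mul_zero, add_zero]
    conv_lhs => rw [← (EuclideanSpace.basisFun (Fin d) ℝ).sum_repr (G x)]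
    simp
  have hWi (i : Fin d) : IntegrableOn (fun x => W x i) Ω :=
    (EuclideanSpace.proj (𝕜 := ℝ) i).integrable_comp hW
  calc ∫ x in Ω, f x * fderiv ℝ ξ x (G x)
      = ∫ x in Ω, ∑ i, f x * fderiv ℝ (fun y => G y i * ξ y) x (EuclideanSpace.single i 1) :=
        setIntegral_congr_fun hΩ.measurableSet fun x hx => by
          simp only [hsum x hx, Finset.mul_sum]
    _ = ∑ i, ∫ x in Ω, f x * fderiv ℝ (fun y => G y i * ξ y) x (EuclideanSpace.single i 1) :=
        integral_finsetSum _ fun i _ => integrable_mul_of_hasCompactSupport hf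
          (((hη i).continuous_fderiv one_ne_zero).clm_apply continuous_const)
          ((hηc i).fderiv_apply ℝ _)
    _ = ∑ i, - ∫ x in Ω, W x i * (G x i * ξ x) :=
        Finset.sum_congr rfl fun i _ => h.integral_mul_fderiv hΩ hf hW (hη i) (hηc i) (hηs i) i
    _ = - ∫ x in Ω, ∑ i, W x i * (G x i * ξ x) := by
        rw [integral_finsetSum _ fun i _ => integrable_mul_of_hasCompactSupport (hWi i)
          (hη i).continuous (hηc i), Finset.sum_neg_distrib]
    _ = - ∫ x in Ω, ξ x * inner ℝ (G x) (W x) := by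
        congr 1
        refine integral_congr_ae (ae_of_all _ fun x => ?_)
        simp only [PiLp.inner_apply, Finset.mul_sum]
        refine Finset.sum_congr rfl fun i _ => ?_
        simp
        ring

/-! ### Integration by parts up to a `C^1` boundary. -/

theorem contDiff_graphFun {d : ℕ} {e : Space d} {φ : Space d → ℝ} (hφ : ContDiff ℝ 1 φ) :
    ContDiff ℝ 1 (graphFun e φ) := by
  unfold graphFun
  have h1 : ContDiff ℝ 1 (fun x : Space d => (inner ℝ e x : ℝ)) := contDiff_const.inner ℝ contDiff_id
  exact h1.sub (hφ.comp (contDiff_id.sub (h1.smul contDiff_const)))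

theorem graphFun_add_smul {d : ℕ} {e : Space d} (he : ‖e‖ = 1) (φ : Space d → ℝ) (x : Space d)
    (t : ℝ) : graphFun e φ (x + t • e) = graphFun e φ x + t := by
  have h : (inner ℝ e (x + t • e) : ℝ) = inner ℝ e x + t := by
    rw [inner_add_right, inner_smul_right, real_inner_self_eq_norm_sq, he]
    ring
  simp only [graphFun, h]
  rw [show x + t • e - ((inner ℝ e x : ℝ) + t) • e = x - (inner ℝ e x : ℝ) • e by
    rw [add_smul]; abel]
  ring

theorem fderiv_graphFun_self {d : ℕ} {e : Space d} (he : ‖e‖ = 1) {φ : Space d → ℝ}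
    (hφ : ContDiff ℝ 1 φ) (x : Space d) : fderiv ℝ (graphFun e φ) x e = 1 := by
  have h1 := (((contDiff_graphFun (e := e) hφ).differentiable one_ne_zero x).hasFDerivAt).hasLineDerivAt e
  have h2 : HasLineDerivAt ℝ (graphFun e φ) 1 x e := by
    unfold HasLineDerivAt
    simp only [graphFun_add_smul he]
    exact (hasDerivAt_id (0 : ℝ)).const_add _
  exact h1.unique h2

theorem deriv_smoothTransition_eq_zero {t : ℝ} (ht : 1 < t) : deriv Real.smoothTransition t = 0 := by
  have : Real.smoothTransition =ᶠ[𝓝 t] fun _ => 1 := by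
    filter_upwards [lt_mem_nhds ht] with s hs using Real.smoothTransition.one_of_one_le hs.le
  rw [this.deriv_eq, deriv_const]

theorem integrableOn_of_continuousOn_closure {d : ℕ} {Ω : Set (Space d)}
    (hb : Bornology.IsBounded Ω) {E : Type*} [NormedAddCommGroup E]
    {f : Space d → E} (hf : ContinuousOn f (closure Ω)) : IntegrableOn f Ω :=
  (hf.integrableOn_compact hb.isCompact_closure).mono_set subset_closure

theorem integrableOn_inner_of_continuousOn_closure {d : ℕ} {Ω : Set (Space d)} (hΩ : IsOpen Ω)
    (hb : Bornology.IsBounded Ω) {G W : Space d → Space d} (hG : ContinuousOn G (closure Ω))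
    (hW : IntegrableOn W Ω) : IntegrableOn (fun x => (inner ℝ (G x) (W x) : ℝ)) Ω := by
  obtain ⟨K, hK⟩ := hb.isCompact_closure.exists_bound_of_continuousOn hG
  have hGm : AEStronglyMeasurable G (volume.restrict Ω) :=
    (hG.mono subset_closure).aestronglyMeasurable hΩ.measurableSet
  refine (hW.norm.const_mul K).mono' (hGm.inner hW.aestronglyMeasurable) ?_
  filter_upwards [ae_restrict_mem hΩ.measurableSet] with x hx
  exact (norm_inner_le_norm _ _).trans
    (mul_le_mul_of_nonneg_right (hK x (subset_closure hx)) (norm_nonneg _))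

/-- A smooth cutoff that vanishes above the level `-1 / n` of `q` and equals one below the level
`-2 / n`. -/
def levelCutoff {E : Type*} (q : E → ℝ) (n : ℝ) (x : E) : ℝ :=
  Real.smoothTransition (-(n * q x) - 1)

/-- The localized inequality of integration by parts near a boundary point: the boundary term has
a sign. -/
theorem IsGraphChart.integral_le_zero {d : ℕ} {Ω : Set (Space d)} (hΩ : IsOpen Ω)
    (hb : Bornology.IsBounded Ω) {x₀ : Space d} {U : Set (Space d)} {e : Space d}
    {φ : Space d → ℝ} (hch : IsGraphChart Ω x₀ U e φ)
    {w : Space d → ℝ} {W G : Space d → Space d} (h : IsWeakGradient Ω w W)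
    (hw : ContinuousOn w (closure Ω)) (hW : IntegrableOn W Ω) (hGc : ContinuousOn G (closure Ω))
    (hG : ContDiffOn ℝ 1 G Ω) (hdiv : ∀ x ∈ Ω, divergence G x = 0)
    (hsign : ∀ x ∈ frontier Ω ∩ U, w x * fderiv ℝ (graphFun e φ) x (G x) ≤ 0)
    {ζ : Space d → ℝ} (hζ : ContDiff ℝ 1 ζ) (hζ0 : ∀ x, 0 ≤ ζ x) (hc : HasCompactSupport ζ)
    (hs : tsupport ζ ⊆ U) :
    ∫ x in Ω, (ζ x * inner ℝ (G x) (W x) + w x * fderiv ℝ ζ x (G x)) ≤ 0 := by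
  set q := graphFun e φ with hq
  have hqC : ContDiff ℝ 1 q := contDiff_graphFun hch.contDiff
  have hqe (x) : fderiv ℝ q x e = 1 := fderiv_graphFun_self hch.norm_eq_one hch.contDiff x
  have hwi : IntegrableOn w Ω := integrableOn_of_continuousOn_closure hb hw
  have hζ' : Continuous (fderiv ℝ ζ) := hζ.continuous_fderiv one_ne_zero
  have hq' : Continuous (fderiv ℝ q) := hqC.continuous_fderiv one_ne_zero
  have hinner := integrableOn_inner_of_continuousOn_closure hΩ hb hGc hW
  have i1 : IntegrableOn (fun x => ζ x * (inner ℝ (G x) (W x) : ℝ)) Ω :=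
    (integrable_mul_of_hasCompactSupport hinner hζ.continuous hc).congr
      (ae_of_all _ fun x => mul_comm _ _)
  have c2 : ContinuousOn (fun x => w x * fderiv ℝ ζ x (G x)) (closure Ω) :=
    hw.mul (hζ'.continuousOn.clm_apply hGc)
  have i2 := integrableOn_of_continuousOn_closure hb c2
  set A : Space d → ℝ := fun x => ζ x * inner ℝ (G x) (W x) + w x * fderiv ℝ ζ x (G x) with hA
  have hAi : IntegrableOn A Ω := i1.add i2
  let θ : ℕ → Space d → ℝ := fun n => levelCutoff q n
  -- The density with Dθₙ = -kₙ Dq. It lives in the layer -2/n ≤ q ≤ -1/n and replaces surface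
  -- measure.
  let k : ℕ → Space d → ℝ := fun n x => n * deriv Real.smoothTransition (-(n * q x) - 1)
  have hθC (n) : ContDiff ℝ 1 (θ n) :=
    Real.smoothTransition.contDiff.comp ((contDiff_const.mul hqC).neg.sub contDiff_const)
  have hθ0 (n x) : 0 ≤ θ n x := Real.smoothTransition.nonneg _
  have hθ1 (n x) : θ n x ≤ 1 := Real.smoothTransition.le_one _
  have hk0 (n x) : 0 ≤ k n x :=
    mul_nonneg (Nat.cast_nonneg n) Real.smoothTransition.monotone.deriv_nonneg
  have hkc (n) : Continuous (k n) :=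
    continuous_const.mul ((Real.smoothTransition.contDiff.continuous_deriv (n := 1) le_rfl).comp
      ((continuous_const.mul hqC.continuous).neg.sub continuous_const))
  have hθd (n x v) : fderiv ℝ (θ n) x v = - (k n x * fderiv ℝ q x v) := by
    have h1 : HasFDerivAt (fun y => -((n : ℝ) * q y) - 1) (-((n : ℝ) • fderiv ℝ q x)) x :=
      (((hqC.differentiable one_ne_zero x).hasFDerivAt.const_mul (n : ℝ)).neg).sub_const 1
    have h2 : HasDerivAt Real.smoothTransition (deriv Real.smoothTransition (-(n * q x) - 1))
        (-(n * q x) - 1) :=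
      ((Real.smoothTransition.contDiff (n := 1)).differentiable one_ne_zero _).hasDerivAt
    have h3 := (h2.comp_hasFDerivAt x h1).fderiv
    change fderiv ℝ (Real.smoothTransition ∘ fun y => -((n : ℝ) * q y) - 1) x v = _
    rw [h3]
    simp [k]
    ring
  have hξs (n : ℕ) : tsupport (fun x => ζ x * θ n x) ⊆ Ω := by
    intro x hx
    have hxζ : x ∈ tsupport ζ := tsupport_mul_subset_left hx
    have hxθ : x ∈ tsupport (θ n) := tsupport_mul_subset_right (f := ζ) hx
    rw [hch.mem_iff x (hs hxζ)]
    have hcl : IsClosed {y | 1 ≤ -((n : ℝ) * q y)} :=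
      isClosed_le continuous_const (continuous_const.mul hqC.continuous).neg
    have hmem : x ∈ {y | 1 ≤ -((n : ℝ) * q y)} := by
      refine closure_minimal (fun y hy => ?_) hcl hxθ
      by_contra hlt
      simp only [mem_ofPred_eq, not_le] at hlt
      exact hy (Real.smoothTransition.zero_of_nonpos (by linarith))
    simp only [mem_ofPred_eq] at hmem
    by_contra hneg
    have := mul_nonneg (Nat.cast_nonneg (α := ℝ) n) (not_lt.1 hneg)
    linarith
  -- The test function `ζ θₙ` has compact support in `Ω`, so no boundary term appears; the part of
  -- its gradient that falls on `θₙ` forms the right-hand side.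
  have hid (n : ℕ) : ∫ x in Ω, θ n x * A x = ∫ x in Ω, ζ x * k n x * (w x * fderiv ℝ q x (G x)) := by
    have hξ : ContDiff ℝ 1 (fun x => ζ x * θ n x) := hζ.mul (hθC n)
    have e1 := h.integral_mul_inner hΩ hwi hW hG hdiv hξ (HasCompactSupport.mul_right hc) (hξs n)
    have hd (x) : fderiv ℝ (fun x => ζ x * θ n x) x (G x) =
        θ n x * fderiv ℝ ζ x (G x) - ζ x * k n x * fderiv ℝ q x (G x) := by
      rw [((hζ.differentiable one_ne_zero x).hasFDerivAt.fun_mul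
        ((hθC n).differentiable one_ne_zero x).hasFDerivAt).fderiv]
      simp [hθd]
      ring
    simp only [hd] at e1
    have j1 : IntegrableOn (fun x => w x * (θ n x * fderiv ℝ ζ x (G x))) Ω :=
      integrableOn_of_continuousOn_closure hb
        (hw.mul ((hθC n).continuous.continuousOn.mul (hζ'.continuousOn.clm_apply hGc)))
    have j2 : IntegrableOn (fun x => ζ x * k n x * (w x * fderiv ℝ q x (G x))) Ω :=
      integrableOn_of_continuousOn_closure hb
        ((hζ.continuous.mul (hkc n)).continuousOn.mul
          (hw.mul (hq'.continuousOn.clm_apply hGc)))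
    have j3 : IntegrableOn (fun x => ζ x * θ n x * (inner ℝ (G x) (W x) : ℝ)) Ω :=
      (integrable_mul_of_hasCompactSupport hinner hξ.continuous
        (HasCompactSupport.mul_right hc)).congr (ae_of_all _ fun x => mul_comm _ _)
    have e2 : ∫ x in Ω, θ n x * A x = (∫ x in Ω, ζ x * θ n x * (inner ℝ (G x) (W x) : ℝ)) +
        ∫ x in Ω, w x * (θ n x * fderiv ℝ ζ x (G x)) := by
      rw [← integral_add j3 j1]
      refine integral_congr_ae (ae_of_all _ fun x => ?_)
      simp only [hA]
      ring
    have e3 : ∫ x in Ω, w x * (θ n x * fderiv ℝ ζ x (G x) - ζ x * k n x * fderiv ℝ q x (G x)) =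
        (∫ x in Ω, w x * (θ n x * fderiv ℝ ζ x (G x))) -
          ∫ x in Ω, ζ x * k n x * (w x * fderiv ℝ q x (G x)) := by
      rw [← integral_sub j1 j2]
      refine integral_congr_ae (ae_of_all _ fun x => ?_)
      simp only
      ring
    rw [e3] at e1
    linarith
  set M : ℝ := ∫ x, |fderiv ℝ ζ x e| with hM
  have hζe : Continuous (fun x => fderiv ℝ ζ x e) := hζ'.clm_apply continuous_const
  have hζec : HasCompactSupport (fun x => fderiv ℝ ζ x e) := hc.fderiv_apply ℝ e
  have hζk (n : ℕ) : Integrable (fun x => ζ x * k n x) :=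
    (hζ.continuous.mul (hkc n)).integrable_of_hasCompactSupport (HasCompactSupport.mul_right hc)
  -- Since ∂ₑq = 1, kₙ = -∂ₑθₙ. Moving this derivative onto `ζ` and using 0 ≤ θₙ ≤ 1 bounds the mass
  -- uniformly in `n`.
  have hmass (n : ℕ) : ∫ x in Ω, ζ x * k n x ≤ M := by
    have hθe (x) : fderiv ℝ (θ n) x e = - k n x := by rw [hθd, hqe, mul_one]
    have e1 := integral_mul_fderiv_eq_neg_fderiv_mul_of_integrable (μ := volume) (f := ζ)
      (g := θ n) (v := e)
      ((hζe.mul (hθC n).continuous).integrable_of_hasCompactSupport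
        (HasCompactSupport.mul_right hζec))
      (by simp only [hθe, mul_neg]; exact (hζk n).neg)
      ((hζ.continuous.mul (hθC n).continuous).integrable_of_hasCompactSupport
        (HasCompactSupport.mul_right hc))
      (fun x _ => hζ.differentiable one_ne_zero x)
      (fun x _ => (hθC n).differentiable one_ne_zero x)
    simp only [hθe, mul_neg, integral_neg, neg_inj] at e1
    calc ∫ x in Ω, ζ x * k n x ≤ ∫ x, ζ x * k n x :=
          setIntegral_le_integral (hζk n) (ae_of_all _ fun x => mul_nonneg (hζ0 x) (hk0 n x))
      _ = ∫ x, fderiv ℝ ζ x e * θ n x := e1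
      _ ≤ M := by
          refine integral_mono
            ((hζe.mul (hθC n).continuous).integrable_of_hasCompactSupport
              (HasCompactSupport.mul_right hζec))
            (hζe.integrable_of_hasCompactSupport hζec).abs fun x => ?_
          calc fderiv ℝ ζ x e * θ n x ≤ |fderiv ℝ ζ x e| * 1 :=
                mul_le_mul (le_abs_self _) (hθ1 n x) (hθ0 n x) (abs_nonneg _)
            _ = _ := mul_one _
  have hM0 : 0 ≤ M := integral_nonneg fun _ => abs_nonneg _
  have hlim : Tendsto (fun n => ∫ x in Ω, θ n x * A x) atTop (𝓝 (∫ x in Ω, A x)) := by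
    refine tendsto_integral_of_dominated_convergence (fun x => |A x|)
      (fun n => (hθC n).continuous.aestronglyMeasurable.mul hAi.aestronglyMeasurable) hAi.abs
      (fun n => ae_of_all _ fun x => ?_) ?_
    · rw [norm_mul, Real.norm_eq_abs, Real.norm_eq_abs, abs_of_nonneg (hθ0 n x)]
      exact mul_le_of_le_one_left (abs_nonneg _) (hθ1 n x)
    · filter_upwards [ae_restrict_mem hΩ.measurableSet] with x hx
      by_cases hxζ : x ∈ tsupport ζ
      · have hqx : q x < 0 := (hch.mem_iff x (hs hxζ)).1 hx
        obtain ⟨N, hN⟩ := exists_nat_ge (2 / (-q x))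
        refine tendsto_const_nhds.congr' ?_
        filter_upwards [eventually_ge_atTop N] with n hn
        have h2 : 2 ≤ (n : ℝ) * (-q x) := by
          rw [← div_le_iff₀ (by linarith)]
          exact hN.trans (by exact_mod_cast hn)
        have : θ n x = 1 := Real.smoothTransition.one_of_one_le (by linarith)
        rw [this, one_mul]
      · have hA0 : A x = 0 := by
          have h1 : fderiv ℝ ζ x = 0 :=
            image_eq_zero_of_notMem_tsupport fun h => hxζ (tsupport_fderiv_subset ℝ h)
          simp [hA, image_eq_zero_of_notMem_tsupport hxζ, h1]
        simp [hA0]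
  have hfc : ContinuousOn (fun x => w x * fderiv ℝ q x (G x)) (closure Ω) :=
    hw.mul (hq'.continuousOn.clm_apply hGc)
  have key : ∀ δ > 0, ∫ x in Ω, A x ≤ δ * M := by
    intro δ hδ
    -- The points where the product is at least `δ` form a compact set that misses the boundary by
    -- the sign condition, so `q` has a negative maximum there. For n > 2/c the layer of kₙ avoids
    -- this set.
    obtain ⟨c, hc0, hcK⟩ : ∃ c > 0, ∀ x ∈ closure Ω ∩ tsupport ζ,
        δ ≤ w x * fderiv ℝ q x (G x) → q x ≤ -c := by
      have hKc : IsCompact {x ∈ closure Ω ∩ tsupport ζ | δ ≤ w x * fderiv ℝ q x (G x)} := by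
        refine (hb.isCompact_closure.inter_right (isClosed_tsupport ζ)).of_isClosed_subset ?_
          fun x hx => hx.1
        exact (hfc.mono inter_subset_left).preimage_isClosed_of_isClosed
          (isClosed_closure.inter (isClosed_tsupport ζ)) isClosed_Ici
      rcases eq_empty_or_nonempty {x ∈ closure Ω ∩ tsupport ζ | δ ≤ w x * fderiv ℝ q x (G x)}
        with hem | hne
      · exact ⟨1, one_pos, fun x hx hδx => (eq_empty_iff_forall_notMem.1 hem x ⟨hx, hδx⟩).elim⟩
      · obtain ⟨y, hy, hmax⟩ := hKc.exists_isMaxOn hne hqC.continuous.continuousOn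
        have hyU : y ∈ U := hs hy.1.2
        have hyΩ : y ∈ Ω := by
          by_contra hn
          have := hsign y ⟨⟨hy.1.1, by rwa [hΩ.interior_eq]⟩, hyU⟩
          linarith [hy.2]
        refine ⟨-q y, by linarith [(hch.mem_iff y hyU).1 hyΩ], fun x hx hδx => ?_⟩
        rw [neg_neg]
        exact hmax ⟨hx, hδx⟩
    obtain ⟨N, hN⟩ := exists_nat_gt (2 / c)
    refine le_of_tendsto hlim ?_
    filter_upwards [eventually_ge_atTop N] with n hn
    have hnc : 2 < n * c := by
      rw [← div_lt_iff₀ hc0]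
      exact hN.trans_le (by exact_mod_cast hn)
    rw [hid]
    calc ∫ x in Ω, ζ x * k n x * (w x * fderiv ℝ q x (G x))
        ≤ ∫ x in Ω, δ * (ζ x * k n x) := by
          refine setIntegral_mono_on ?_ ((hζk n).integrableOn.const_mul δ) hΩ.measurableSet
            fun x hx => ?_
          · exact integrableOn_of_continuousOn_closure hb
              ((hζ.continuous.mul (hkc n)).continuousOn.mul hfc)
          · rw [mul_comm δ]
            by_cases hxζ : x ∈ tsupport ζ
            · by_cases hδx : δ ≤ w x * fderiv ℝ q x (G x)
              · have h1 := hcK x ⟨subset_closure hx, hxζ⟩ hδx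
                have h2 : k n x = 0 := by
                  have : (n : ℝ) * q x ≤ n * (-c) := mul_le_mul_of_nonneg_left h1 (Nat.cast_nonneg n)
                  simp only [k]
                  rw [deriv_smoothTransition_eq_zero (by linarith), mul_zero]
                simp [h2]
              · exact mul_le_mul_of_nonneg_left (not_le.1 hδx).le
                  (mul_nonneg (hζ0 x) (hk0 n x))
            · simp [image_eq_zero_of_notMem_tsupport hxζ]
      _ = δ * ∫ x in Ω, ζ x * k n x := integral_const_mul _ _
      _ ≤ δ * M := mul_le_mul_of_nonneg_left (hmass n) hδ.le
  refine le_of_forall_pos_le_add fun ε hε => ?_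
  refine (key (ε / (M + 1)) (by positivity)).trans ?_
  rw [zero_add, div_mul_eq_mul_div, div_le_iff₀ (by positivity)]
  nlinarith

/-- The inequality of integration by parts for a solenoidal field on a `C^1` domain: if the product of
`w` and the normal flux of `G` is nonpositive on the boundary, then `∫ G · Dw ≤ 0`. -/
theorem IsC1Domain.integral_inner_le_zero {d : ℕ} {Ω : Set (Space d)} (hΩ : IsC1Domain Ω)
    {w : Space d → ℝ} {W G : Space d → Space d} (h : IsWeakGradient Ω w W)
    (hw : ContinuousOn w (closure Ω)) (hW : IntegrableOn W Ω) (hGc : ContinuousOn G (closure Ω))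
    (hG : ContDiffOn ℝ 1 G Ω) (hdiv : ∀ x ∈ Ω, divergence G x = 0)
    (hsign : ∀ x ∈ frontier Ω, ∀ U e φ, IsGraphChart Ω x U e φ →
      w x * fderiv ℝ (graphFun e φ) x (G x) ≤ 0) :
    ∫ x in Ω, (inner ℝ (G x) (W x) : ℝ) ≤ 0 := by
  have hb := hΩ.isBounded
  have hwi : IntegrableOn w Ω := integrableOn_of_continuousOn_closure hb hw
  have hinner := integrableOn_inner_of_continuousOn_closure hΩ.isOpen hb hGc hW
  have hi2 {ζ : Space d → ℝ} (hζ : ContDiff ℝ 1 ζ) :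
      IntegrableOn (fun x => w x * fderiv ℝ ζ x (G x)) Ω :=
    integrableOn_of_continuousOn_closure hb
      (hw.mul ((hζ.continuous_fderiv one_ne_zero).continuousOn.clm_apply hGc))
  have hi1 {ζ : Space d → ℝ} (hζ : ContDiff ℝ 1 ζ) (hc : HasCompactSupport ζ) :
      IntegrableOn (fun x => ζ x * (inner ℝ (G x) (W x) : ℝ)) Ω :=
    (integrable_mul_of_hasCompactSupport hinner hζ.continuous hc).congr
      (ae_of_all _ fun x => mul_comm _ _)
  have hloc : ∀ x ∈ closure Ω, ∃ V : Set (Space d), IsOpen V ∧ x ∈ V ∧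
      ∀ ζ : Space d → ℝ, ContDiff ℝ 1 ζ → (∀ x, 0 ≤ ζ x) → HasCompactSupport ζ → tsupport ζ ⊆ V →
        ∫ x in Ω, (ζ x * inner ℝ (G x) (W x) + w x * fderiv ℝ ζ x (G x)) ≤ 0 := by
    intro x hx
    by_cases hxΩ : x ∈ Ω
    · refine ⟨Ω, hΩ.isOpen, hxΩ, fun ζ hζ _ hc hs => ?_⟩
      rw [integral_add (hi1 hζ hc) (hi2 hζ),
        h.integral_mul_inner hΩ.isOpen hwi hW hG hdiv hζ hc hs, add_neg_cancel]
    · obtain ⟨U, e, φ, hch⟩ := hΩ.exists_chart x ⟨hx, by rwa [hΩ.isOpen.interior_eq]⟩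
      refine ⟨U, hch.isOpen, hch.mem, fun ζ hζ h0 hc hs =>
        hch.integral_le_zero hΩ.isOpen hb h hw hW hGc hG hdiv (fun y hy => ?_) hζ h0 hc hs⟩
      exact hsign y hy.1 U e φ ⟨hch.norm_eq_one, hch.contDiff, hch.isOpen, hy.2, hch.mem_iff⟩
  choose! V hVo hxV hV using hloc
  obtain ⟨t, htΩ, hcov⟩ := hb.isCompact_closure.elim_nhds_subcover
    -- The unit balls give the functions of the partition of unity compact support.
    (fun x => V x ∩ Metric.ball x 1)
    fun x hx => inter_mem ((hVo x hx).mem_nhds (hxV x hx)) (Metric.ball_mem_nhds x one_pos)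
  obtain ⟨ρ, hρ⟩ := SmoothPartitionOfUnity.exists_isSubordinate (modelWithCornersSelf ℝ (Space d))
    (isClosed_closure (s := Ω)) (fun i : t => V i ∩ Metric.ball (i : Space d) 1)
    (fun i => (hVo i (htΩ i i.2)).inter Metric.isOpen_ball)
    (hcov.trans (iUnion₂_subset fun x hx => subset_iUnion_of_subset (⟨x, hx⟩ : t) subset_rfl))
  have hρC (i : t) : ContDiff ℝ 1 (ρ i) :=
    (contMDiff_iff_contDiff.1 (ρ i).contMDiff).of_le (by exact_mod_cast le_top)
  have hρc (i : t) : HasCompactSupport (ρ i) :=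
    Metric.isCompact_of_isClosed_isBounded (isClosed_tsupport _)
      (Metric.isBounded_ball.subset ((hρ i).trans inter_subset_right))
  have hsum1 (x : Space d) (hx : x ∈ closure Ω) : ∑ i : t, ρ i x = 1 := by
    rw [← ρ.sum_eq_one hx, finsum_eq_sum_of_fintype]
  -- The partition sums to one near `x`, so the terms with derivatives of the cutoffs cancel in the
  -- sum.
  have hsum0 (x : Space d) (hx : x ∈ Ω) (v : Space d) : ∑ i : t, fderiv ℝ (ρ i) x v = 0 := by
    have h1 : HasFDerivAt (fun y => ∑ i : t, ρ i y) (∑ i : t, fderiv ℝ (ρ i) x) x :=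
      HasFDerivAt.fun_sum fun i _ => ((hρC i).differentiable one_ne_zero x).hasFDerivAt
    have h2 : HasFDerivAt (fun y => ∑ i : t, ρ i y) (0 : Space d →L[ℝ] ℝ) x := by
      refine (hasFDerivAt_const (1 : ℝ) x).congr_of_eventuallyEq ?_
      filter_upwards [hΩ.isOpen.mem_nhds hx] with y hy using hsum1 y (subset_closure hy)
    have h3 := congrArg (fun L : Space d →L[ℝ] ℝ => L v) (h1.unique h2)
    simpa using h3
  calc ∫ x in Ω, (inner ℝ (G x) (W x) : ℝ)
      = ∫ x in Ω, ∑ i : t, (ρ i x * inner ℝ (G x) (W x) + w x * fderiv ℝ (ρ i) x (G x)) := by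
        refine setIntegral_congr_fun hΩ.isOpen.measurableSet fun x hx => ?_
        rw [Finset.sum_add_distrib, ← Finset.sum_mul, ← Finset.mul_sum, hsum0 x hx,
          hsum1 x (subset_closure hx)]
        ring
    _ = ∑ i : t, ∫ x in Ω, (ρ i x * inner ℝ (G x) (W x) + w x * fderiv ℝ (ρ i) x (G x)) :=
        integral_finsetSum _ fun i _ => (hi1 (hρC i) (hρc i)).add (hi2 (hρC i))
    _ ≤ 0 := Finset.sum_nonpos fun i _ =>
        hV i (htΩ i i.2) (ρ i) (hρC i) (ρ.nonneg i) (hρc i) ((hρ i).trans inter_subset_left)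

/-! ### From almost every to every boundary point. -/

theorem IsGraphChart.mem_frontier {d : ℕ} {Ω : Set (Space d)} (hΩ : IsOpen Ω) {x₀ : Space d}
    {U : Set (Space d)} {e : Space d} {φ : Space d → ℝ} (hch : IsGraphChart Ω x₀ U e φ)
    {x : Space d} (hxU : x ∈ U) (hx : graphFun e φ x = 0) : x ∈ frontier Ω := by
  refine ⟨?_, fun h => ?_⟩
  · have hlim : Tendsto (fun t : ℝ => x + (-t) • e) (𝓝[>] 0) (𝓝 x) := by
      have : Tendsto (fun t : ℝ => x + (-t) • e) (𝓝 0) (𝓝 (x + (-(0 : ℝ)) • e)) :=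
        (continuous_const.add (continuous_neg.smul continuous_const)).tendsto 0
      simpa using this.mono_left nhdsWithin_le_nhds
    refine mem_closure_of_tendsto hlim ?_
    filter_upwards [hlim (hch.isOpen.mem_nhds hxU), self_mem_nhdsWithin] with t ht ht0
    rw [hch.mem_iff _ ht, graphFun_add_smul hch.norm_eq_one, hx]
    simpa using ht0
  · rw [hΩ.interior_eq, hch.mem_iff x hxU, hx] at h
    exact lt_irrefl _ h

theorem IsGraphChart.graphFun_eq_zero {d : ℕ} {Ω : Set (Space d)} (hΩ : IsOpen Ω) {x₀ : Space d}
    {U : Set (Space d)} {e : Space d} {φ : Space d → ℝ} (hch : IsGraphChart Ω x₀ U e φ)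
    {x : Space d} (hxU : x ∈ U) (hx : x ∈ frontier Ω) : graphFun e φ x = 0 := by
  refine le_antisymm (not_lt.1 fun hpos => ?_) (not_lt.1 fun hneg => ?_)
  · have hO : IsOpen (U ∩ {y | 0 < graphFun e φ y}) :=
      hch.isOpen.inter (isOpen_lt continuous_const (contDiff_graphFun hch.contDiff).continuous)
    obtain ⟨y, ⟨hyU, hy⟩, hyΩ⟩ := mem_closure_iff.1 hx.1 _ hO ⟨hxU, hpos⟩
    exact lt_asymm hy ((hch.mem_iff y hyU).1 hyΩ)
  · exact hx.2 (by rw [hΩ.interior_eq]; exact (hch.mem_iff x hxU).2 hneg)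

/-- Nonempty relatively open subsets of the boundary have positive surface measure. -/
theorem IsGraphChart.surfaceMeasure_ne_zero {d : ℕ} (hd : 0 < d) {Ω : Set (Space d)}
    (hΩ : IsOpen Ω) {x₀ : Space d} {U : Set (Space d)} {e : Space d} {φ : Space d → ℝ}
    (hch : IsGraphChart Ω x₀ U e φ) (hx₀ : x₀ ∈ frontier Ω) {O : Set (Space d)} (hO : IsOpen O)
    (hxO : x₀ ∈ O) : surfaceMeasure d (O ∩ frontier Ω) ≠ 0 := by
  have he0 : e ≠ 0 := fun h => by simpa [h] using hch.norm_eq_one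
  have hee : (inner ℝ e e : ℝ) = 1 := by rw [real_inner_self_eq_norm_sq, hch.norm_eq_one, one_pow]
  let K : Submodule ℝ (Space d) := (ℝ ∙ e)ᗮ
  have hfin : Module.finrank ℝ K = d - 1 := by
    have : Fact (Module.finrank ℝ (Space d) = (d - 1) + 1) := ⟨by simp; omega⟩
    exact Submodule.finrank_orthogonal_span_singleton he0
  have hKe (y : K) : (inner ℝ e (y : Space d) : ℝ) = 0 :=
    Submodule.mem_orthogonal_singleton_iff_inner_right.1 y.2
  -- The graph parametrization, with the orthogonal projection to e^⊥ as left inverse. The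
  -- projection is 1-Lipschitz, so a null piece of the boundary would project to a null set; but
  -- that image contains a nonempty open set of the hyperplane.
  let s : K → Space d := fun y => (y : Space d) + φ y • e
  have hs : Continuous s := continuous_subtype_val.add
    ((hch.contDiff.continuous.comp continuous_subtype_val).smul continuous_const)
  have hes (y : K) : (inner ℝ e (s y) : ℝ) = φ y := by
    simp only [s, inner_add_right, hKe, inner_smul_right, hee]
    ring
  have hqs (y : K) : graphFun e φ (s y) = 0 := by
    have h1 : s y - φ y • e = y := by simp [s]
    rw [graphFun, hes, h1, sub_self]
  have hπe : K.orthogonalProjectionOnto e = 0 :=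
    Submodule.orthogonalProjectionOnto_orthogonal_apply_eq_zero (Submodule.mem_span_singleton_self e)
  have hπs (y : K) : K.orthogonalProjectionOnto (s y) = y := by
    simp [s, hπe]
  have hx₀s : s (K.orthogonalProjectionOnto x₀) = x₀ := by
    have h0 := hch.graphFun_eq_zero hΩ hch.mem hx₀
    have hmem : x₀ - (inner ℝ e x₀ : ℝ) • e ∈ K := by
      rw [Submodule.mem_orthogonal_singleton_iff_inner_right, inner_sub_right, inner_smul_right,
        hee, mul_one, sub_self]
    have h1 : (K.orthogonalProjectionOnto x₀ : Space d) = x₀ - (inner ℝ e x₀ : ℝ) • e := by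
      have : K.orthogonalProjectionOnto (x₀ - (inner ℝ e x₀ : ℝ) • e) = K.orthogonalProjectionOnto x₀ := by
        rw [map_sub, map_smul, hπe, smul_zero, sub_zero]
      rw [← this, Submodule.orthogonalProjectionOnto_mem_subspace_eq_self ⟨_, hmem⟩]
    rw [graphFun, sub_eq_zero] at h0
    simp only [s]
    rw [h1, ← h0]
    abel
  have hsub : s ⁻¹' (O ∩ U) ⊆ K.orthogonalProjectionOnto '' (O ∩ frontier Ω) := fun y hy =>
    ⟨s y, ⟨hy.1, hch.mem_frontier hΩ hy.2 (hqs y)⟩, hπs y⟩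
  have hLip : LipschitzWith 1 K.orthogonalProjectionOnto :=
    K.orthogonalProjectionOnto.lipschitz.weaken (by exact_mod_cast K.orthogonalProjectionOnto_norm_le)
  intro hzero
  have hH : μH[((d - 1 : ℕ) : ℝ)] (O ∩ frontier Ω) = 0 := by
    rw [surfaceMeasure, Measure.euclideanHausdorffMeasure_def, Measure.smul_apply] at hzero
    have := Measure.addHaarScalarFactor_volume_hausdorffMeasure_ne_zero (d - 1)
    simpa [this] using hzero
  have hN0 : (μHE[Module.finrank ℝ K] : Measure K) (s ⁻¹' (O ∩ U)) = 0 := by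
    have h1 : μH[((d - 1 : ℕ) : ℝ)] (K.orthogonalProjectionOnto '' (O ∩ frontier Ω)) = 0 := by
      refine le_antisymm ((hLip.hausdorffMeasure_image_le (Nat.cast_nonneg _) _).trans ?_) zero_le
      rw [hH, mul_zero]
    rw [hfin, Measure.euclideanHausdorffMeasure_def, Measure.smul_apply, measure_mono_null hsub h1,
      smul_zero]
  exact ((hO.inter hch.isOpen).preimage hs).measure_ne_zero _
    ⟨K.orthogonalProjectionOnto x₀, by rw [mem_preimage, hx₀s]; exact ⟨hxO, hch.mem⟩⟩ hN0

/-- A property that holds almost everywhere on a relatively open part of the boundary holds on a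
dense subset of it. -/
theorem IsC1Domain.subset_closure_of_ae {d : ℕ} (hd : 0 < d) {Ω S : Set (Space d)}
    (hΩ : IsC1Domain Ω) (hS : ∃ O, IsOpen O ∧ S = O ∩ frontier Ω) {p : Space d → Prop}
    (hp : ∀ᵐ x ∂(surfaceMeasure d).restrict S, p x) : S ⊆ closure {x ∈ S | p x} := by
  obtain ⟨O, hO, rfl⟩ := hS
  intro x hx
  rw [mem_closure_iff]
  intro V hV hxV
  by_contra hne
  obtain ⟨U, e, φ, hch⟩ := hΩ.exists_chart x hx.2
  refine hch.surfaceMeasure_ne_zero hd hΩ.isOpen hx.2 (hV.inter hO) ⟨hxV, hx.1⟩ ?_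
  rw [ae_restrict_iff' (hO.measurableSet.inter isClosed_frontier.measurableSet)] at hp
  refine measure_mono_null (fun y hy => ?_) hp
  intro hy'
  exact hne ⟨y, hy.1.1, ⟨hy.1.2, hy.2⟩, hy' ⟨hy.1.2, hy.2⟩⟩

/-- An inequality between continuous functions passes from almost every point of a relatively open
part of the boundary to its closure. -/
theorem IsC1Domain.nonneg_of_ae {d : ℕ} (hd : 0 < d) {Ω S : Set (Space d)}
    (hΩ : IsC1Domain Ω) (hS : ∃ O, IsOpen O ∧ S = O ∩ frontier Ω) {p : Space d → Prop}
    (hp : ∀ᵐ x ∂(surfaceMeasure d).restrict S, p x) {f : Space d → ℝ}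
    (hf : ContinuousOn f (closure Ω)) {U : Set (Space d)} (hU : IsOpen U)
    (hpf : ∀ y ∈ S ∩ U, p y → 0 ≤ f y) {x : Space d} (hxS : x ∈ closure S) (hxU : x ∈ U) :
    0 ≤ f x := by
  have hSΩ : S ⊆ closure Ω := by
    obtain ⟨O, -, rfl⟩ := hS
    exact fun y hy => hy.2.1
  have h1 : x ∈ closure {y ∈ S | p y} :=
    closure_minimal (hΩ.subset_closure_of_ae hd hS hp) isClosed_closure hxS
  have h2 : x ∈ closure ({y ∈ S | p y} ∩ U) := by
    rw [inter_comm]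
    exact hU.inter_closure ⟨hxU, h1⟩
  have h3 : ContinuousWithinAt f ({y ∈ S | p y} ∩ U) x :=
    (hf x (closure_minimal hSΩ isClosed_closure hxS)).mono fun y hy => hSΩ hy.1.1
  have h4 := h3.mem_closure h2 (t := Ici 0) fun y hy => hpf y ⟨hy.1.1, hy.2⟩ hy.1.2
  rwa [isClosed_Ici.closure_eq] at h4

/-! ### The flux and its boundary conditions. -/

/-- The partial gradient of a `C^2` function of two variables is `C^1`, up to the boundary of the
domain of the first variable. -/
theorem contDiffOn_gradient_snd {E F : Type*} [NormedAddCommGroup E] [NormedSpace ℝ E]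
    [NormedAddCommGroup F] [InnerProductSpace ℝ F] [CompleteSpace F] {X : Set E} {H : E → F → ℝ}
    (hH : ContDiffOn ℝ 2 (fun q : E × F => H q.1 q.2) (X ×ˢ univ)) :
    ContDiffOn ℝ 1 (fun q : E × F => ∇ (H q.1) q.2) (X ×ˢ univ) := by
  intro q hq
  have h2 : ContDiffWithinAt ℝ (1 + 1) (fun q : E × F => H q.1 q.2) (X ×ˢ univ) q := by
    rw [one_add_one_eq_two]
    exact hH q hq
  -- Derivatives within `X ×ˢ univ` need not be unique, so a local `C^1` choice `f'` is taken. Its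
  -- restriction to the second factor is unambiguous, as the fibres are the whole space.
  obtain ⟨N, hN, hNs, -, f', hf', hf'1⟩ :=
    (contDiffWithinAt_succ_iff_hasFDerivWithinAt' (by simp)).1 h2
  rw [insert_eq_of_mem hq] at hN hNs
  have heq (y : E × F) (hy : y ∈ N) : ∇ (H y.1) y.2 =
      (InnerProductSpace.toDual ℝ F).symm ((f' y).comp (ContinuousLinearMap.inr ℝ E F)) := by
    have h3 : HasFDerivWithinAt (fun p : F => (y.1, p)) (ContinuousLinearMap.inr ℝ E F) univ y.2 :=
      (hasFDerivAt_prodMk_right y.1 y.2).hasFDerivWithinAt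
    have h4 : HasFDerivWithinAt (H y.1) ((f' y).comp (ContinuousLinearMap.inr ℝ E F)) univ y.2 :=
      HasFDerivWithinAt.comp (t := X ×ˢ univ) (g := fun q : E × F => H q.1 q.2) y.2 (hf' y hy) h3
        (fun p _ => ⟨(hNs hy).1, mem_univ _⟩)
    rw [hasFDerivWithinAt_univ] at h4
    rw [gradient, h4.fderiv]
  have hC : ContDiffWithinAt ℝ 1 (fun y => (InnerProductSpace.toDual ℝ F).symm
      ((f' y).comp (ContinuousLinearMap.inr ℝ E F))) (X ×ˢ univ) q := by
    have := hf'1.clm_comp (contDiffWithinAt_const (c := ContinuousLinearMap.inr ℝ E F))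
    exact (InnerProductSpace.toDual ℝ F).symm.contDiff.contDiffAt.comp_contDiffWithinAt q this
  refine hC.congr_of_eventuallyEq ?_ (heq q (mem_of_mem_nhdsWithin hq hN))
  filter_upwards [hN] with y hy using heq y hy

theorem contDiffOn_gradient {F : Type*} [NormedAddCommGroup F] [InnerProductSpace ℝ F]
    [CompleteSpace F] {Ω : Set F} (hΩ : IsOpen Ω) {u : F → ℝ} (hu : ContDiffOn ℝ 2 u Ω) :
    ContDiffOn ℝ 1 (∇ u) Ω :=
  (InnerProductSpace.toDual ℝ F).symm.contDiff.comp_contDiffOn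
    (hu.fderiv_of_isOpen hΩ (by norm_num [one_add_one_eq_two]))

/-- The flux `F = m D_pH(x, Du)` of a classical solution, with its boundary conditions written in
terms of the defining functions of graph charts. -/
structure IsFlux {d : ℕ} (Ω ΓD ΓN : Set (Space d)) (j ψ u : Space d → ℝ)
    (F : Space d → Space d) : Prop where
  continuousOn : ContinuousOn F (closure Ω)
  contDiffOn : ContDiffOn ℝ 1 F Ω
  divergence_eq_zero : ∀ x ∈ Ω, divergence F x = 0
  neumann : ∀ᵐ x ∂(surfaceMeasure d).restrict ΓN, ∀ U e φ, IsGraphChart Ω x U e φ →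
    fderiv ℝ (graphFun e φ) x (F x) = ‖∇ (graphFun e φ) x‖ * j x
  outflow : ∀ᵐ x ∂(surfaceMeasure d).restrict ΓD, ∀ U e φ, IsGraphChart Ω x U e φ →
    fderiv ℝ (graphFun e φ) x (F x) ≤ 0
  exit_cost : ∀ᵐ x ∂(surfaceMeasure d).restrict ΓD, u x ≤ ψ x
  contact : ∀ᵐ x ∂(surfaceMeasure d).restrict ΓD, ∀ U e φ, IsGraphChart Ω x U e φ →
    (ψ x - u x) * fderiv ℝ (graphFun e φ) x (F x) = 0

theorem divergence_congr {d : ℕ} {F G : Space d → Space d} {x : Space d} (h : F =ᶠ[𝓝 x] G) :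
    divergence F x = divergence G x := by
  simp only [divergence, h.fderiv_eq]

theorem divergence_sub {d : ℕ} {F G : Space d → Space d} {x : Space d}
    (hF : DifferentiableAt ℝ F x) (hG : DifferentiableAt ℝ G x) :
    divergence (fun y => F y - G y) x = divergence F x - divergence G x := by
  simp only [divergence, fderiv_fun_sub hF hG, ← Finset.sum_sub_distrib]
  rfl

/-- The normal flux is rewritten through F·∇q = |∇q| F·ν, where |∇q| ≠ 0 because ∂ₑq = 1. Unlike ν,
the field ∇q is defined and continuous off the boundary too, which allows limits in the boundary
conditions. -/
theorem IsClassicalSolution.exists_isFlux {d : ℕ} {Ω ΓD ΓN : Set (Space d)} (hΩ : IsOpen Ω)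
    {β C : ℝ} {g : ℝ → ℝ} {H : Space d → Space d → ℝ} {j ψ m u : Space d → ℝ}
    (hH : HamiltonianAssumption Ω β C H) (h : IsClassicalSolution Ω ΓD ΓN g H j ψ m u) :
    ∃ P F : Space d → Space d, ContinuousOn P (closure Ω) ∧ (∀ x ∈ Ω, P x = ∇ u x) ∧
      (∀ x ∈ Ω, F x = m x • ∇ (H x) (∇ u x)) ∧ IsFlux Ω ΓD ΓN j ψ u F := by
  obtain ⟨P, hPc, hPu, hbc⟩ := h.boundary
  have hDp := contDiffOn_gradient_snd hH.contDiffOn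
  have heq : ∀ x ∈ Ω, m x • ∇ (H x) (P x) = m x • ∇ (H x) (∇ u x) := fun x hx => by
    rw [hPu x hx]
  have hC : ContDiffOn ℝ 1 (fun x => m x • ∇ (H x) (∇ u x)) Ω :=
    h.contDiffOn_m.smul (hDp.comp (contDiffOn_id.prodMk (contDiffOn_gradient hΩ h.contDiffOn_u))
      fun x hx => ⟨subset_closure hx, mem_univ _⟩)
  have hflux {x U e φ} (hch : IsGraphChart Ω x U e φ) : ∃ ν, IsOutwardNormal Ω x ν ∧
      fderiv ℝ (graphFun e φ) x (m x • ∇ (H x) (P x)) =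
        ‖∇ (graphFun e φ) x‖ * (m x * inner ℝ (∇ (H x) (P x)) ν) := by
    refine ⟨_, ⟨U, e, φ, hch, rfl⟩, ?_⟩
    have hne : ‖∇ (graphFun e φ) x‖ ≠ 0 := by
      intro h0
      have h1 := fderiv_graphFun_self hch.norm_eq_one hch.contDiff x
      rw [← inner_gradient_left, norm_eq_zero.1 h0, inner_zero_left] at h1
      exact zero_ne_one h1
    rw [inner_smul_right, real_inner_comm, inner_gradient_left, map_smul, smul_eq_mul]
    field_simp
  refine ⟨P, fun x => m x • ∇ (H x) (P x), hPc, hPu, heq, ?_, ?_, ?_, ?_, ?_, hbc.exit_cost, ?_⟩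
  · exact h.continuousOn_m.smul (hDp.continuousOn.comp (continuousOn_id.prodMk hPc)
      fun x hx => ⟨hx, mem_univ _⟩)
  · exact hC.congr heq
  · intro x hx
    rw [divergence_congr (G := fun y => m y • ∇ (H y) (∇ u y))]
    · simpa using h.transport x hx
    · filter_upwards [hΩ.mem_nhds hx] with y hy using heq y hy
  · filter_upwards [hbc.neumann] with x hx U e φ hch
    obtain ⟨ν, hν, hfl⟩ := hflux hch
    rw [hfl, hx ν hν]
  · filter_upwards [hbc.outflow] with x hx U e φ hch
    obtain ⟨ν, hν, hfl⟩ := hflux hch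
    rw [hfl]
    exact mul_nonpos_of_nonneg_of_nonpos (norm_nonneg _) (hx ν hν)
  · filter_upwards [hbc.contact] with x hx U e φ hch
    obtain ⟨ν, hν, hfl⟩ := hflux hch
    rw [hfl, mul_left_comm, hx ν hν, mul_zero]

/-- Comparison of the fluxes of two solutions with the same data: the boundary terms of the weak
formulation have a sign. -/
theorem IsFlux.integral_inner_sub_le_zero {d : ℕ} (hd : 0 < d) {Ω ΓD ΓN : Set (Space d)}
    (hΩ : IsC1Domain Ω) (hΓ : IsBoundaryPartition Ω ΓD ΓN) {j ψ u v : Space d → ℝ}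
    {F G W P : Space d → Space d} (hF : IsFlux Ω ΓD ΓN j ψ u F) (hG : IsFlux Ω ΓD ΓN j ψ v G)
    (hψ : ContinuousOn ψ (closure Ω)) (hW : IsWeakGradient Ω ψ W) (hWi : IntegrableOn W Ω)
    (huc : ContinuousOn u (closure Ω)) (hu : ContDiffOn ℝ 1 u Ω)
    (hPc : ContinuousOn P (closure Ω)) (hPu : ∀ x ∈ Ω, P x = ∇ u x) :
    IntegrableOn (fun x => (inner ℝ (F x - G x) (∇ u x - W x) : ℝ)) Ω ∧
      ∫ x in Ω, (inner ℝ (F x - G x) (∇ u x - W x) : ℝ) ≤ 0 := by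
  have hb := hΩ.isBounded
  have hDu : IntegrableOn (∇ u) Ω :=
    (integrableOn_of_continuousOn_closure hb hPc).congr_fun hPu hΩ.isOpen.measurableSet
  have hw := (isWeakGradient_gradient hΩ.isOpen hu).sub hW
    (integrableOn_of_continuousOn_closure hb huc) (integrableOn_of_continuousOn_closure hb hψ)
    hDu hWi
  have hFG : ContinuousOn (fun x => F x - G x) (closure Ω) := hF.continuousOn.sub hG.continuousOn
  refine ⟨integrableOn_inner_of_continuousOn_closure hΩ.isOpen hb hFG (hDu.sub hWi),
    hΩ.integral_inner_le_zero hw (huc.sub hψ) (hDu.sub hWi) hFG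
      (hF.contDiffOn.sub hG.contDiffOn) ?_ ?_⟩
  · intro x hx
    have hdiff {f : Space d → Space d} (hf : ContDiffOn ℝ 1 f Ω) : DifferentiableAt ℝ f x :=
      (hf.contDiffAt (hΩ.isOpen.mem_nhds hx)).differentiableAt one_ne_zero
    rw [divergence_sub (hdiff hF.contDiffOn) (hdiff hG.contDiffOn), hF.divergence_eq_zero x hx,
      hG.divergence_eq_zero x hx, sub_zero]
  · intro x hx U e φ hch
    have hchart {y} (hy : y ∈ U) : IsGraphChart Ω y U e φ :=
      ⟨hch.norm_eq_one, hch.contDiff, hch.isOpen, hy, hch.mem_iff⟩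
    have hc : ContinuousOn (fun y => (ψ y - u y) * fderiv ℝ (graphFun e φ) y (F y - G y))
        (closure Ω) :=
      (hψ.sub huc).mul ((((contDiff_graphFun hch.contDiff).continuous_fderiv
        one_ne_zero).continuousOn).clm_apply hFG)
    suffices hsuff : 0 ≤ (ψ x - u x) * fderiv ℝ (graphFun e φ) x (F x - G x) by linarith
    rw [hΓ.cover] at hx
    rcases hx with hxD | hxN
    · refine hΩ.nonneg_of_ae hd hΓ.relOpen_D (hF.contact.and (hF.exit_cost.and hG.outflow)) hc
        hch.isOpen ?_ hxD hch.mem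
      -- By contact only -(ψ - u) Dq(G) is left, with ψ - u ≥ 0 and Dq(G) ≤ 0.
      rintro y hy ⟨h1, h2, h3⟩
      have h1 := h1 U e φ (hchart hy.2)
      have h3 := h3 U e φ (hchart hy.2)
      rw [map_sub, mul_sub, h1]
      nlinarith
    · refine hΩ.nonneg_of_ae hd hΓ.relOpen_N (hF.neumann.and hG.neumann) hc
        hch.isOpen ?_ hxN hch.mem
      rintro y hy ⟨h1, h2⟩
      rw [map_sub, h1 U e φ (hchart hy.2), h2 U e φ (hchart hy.2), sub_self, mul_zero]

/-! ### Pointwise absorption by Young's inequality. -/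

theorem exists_young_le {p q ε : ℝ} (hpq : p.HolderConjugate q) (hε : 0 < ε) :
    ∃ K : ℝ, 0 ≤ K ∧ ∀ a b : ℝ, 0 ≤ a → 0 ≤ b → a * b ≤ ε * a ^ p + K * b ^ q := by
  have hp := hpq.pos
  have hq := hpq.symm.pos
  set l : ℝ := ε ^ (1 / p) with hl
  have hl0 : 0 < l := Real.rpow_pos_of_pos hε _
  have hlp : l ^ p = ε := by rw [hl, ← Real.rpow_mul hε.le, one_div_mul_cancel hp.ne', Real.rpow_one]
  refine ⟨(l⁻¹) ^ q, by positivity, fun a b ha hb => ?_⟩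
  have h1 := Real.young_inequality_of_nonneg (a := l * a) (b := l⁻¹ * b) (by positivity)
    (by positivity) hpq
  have h2 : l * a * (l⁻¹ * b) = a * b := by field_simp
  rw [h2, Real.mul_rpow hl0.le ha, Real.mul_rpow (by positivity) hb, hlp] at h1
  refine h1.trans (add_le_add ?_ ?_)
  · exact div_le_self (by positivity) hpq.lt.le
  · exact div_le_self (by positivity) hpq.symm.lt.le

/-- Here s, p, τ, G stand for m, |Du|, |Dψ|, g(m), and `B` bounds the comparison flux. In s p^(β-1)
τ, Young with exponent β leaves s τ^β, and a second Young with exponent α leaves τ^(αβ): hence γ =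
αβ. -/
theorem exists_pointwise_bound {α β C B z₀ K₁ : ℝ} (hα : 1 < α) (hβ : 1 < β) (hC : 0 < C)
    (hB : 0 ≤ B) (hK₁ : 0 ≤ K₁) :
    ∃ K : ℝ, 0 ≤ K ∧ ∀ s p τ G : ℝ, 0 ≤ s → 0 ≤ p → 0 ≤ τ → 0 ≤ G →
      (z₀ ≤ s → s ^ (1 / (α - 1)) / C ≤ G) → p ^ β / C - C ≤ G → G ≤ s * G + K₁ →
      C * s + s * (C * (p ^ (β - 1) + 1)) * τ + B * p + B * τ ≤
        (s * p ^ β / C + s * G) / 2 + K * (1 + τ ^ (α * β)) := by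
  have hα1 : 0 < α - 1 := by linarith
  have hβ1 : 0 < β - 1 := by linarith
  have hconjα : (α / (α - 1)).HolderConjugate α := (Real.HolderConjugate.conjExponent hα).symm
  have hconjβ : (β / (β - 1)).HolderConjugate β := (Real.HolderConjugate.conjExponent hβ).symm
  -- The budget: `ya` is used three times at cost sG/12 each, `yc` costs sG/4, together sG/2; `yb`
  -- costs half of s p^β/C.
  obtain ⟨Ka, hKa, ya⟩ := exists_young_le hconjα (show 0 < 1 / (12 * C) by positivity)
  obtain ⟨Kb, hKb, yb⟩ := exists_young_le hconjβ (show 0 < 1 / (2 * C) by positivity)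
  obtain ⟨Kc, hKc, yc⟩ := exists_young_le hconjβ.symm (show 0 < 1 / (4 * C) by positivity)
  -- Bounds s^(α/(α-1)) when s < z₀, where the growth condition is silent.
  set K₂ : ℝ := |z₀| ^ (α / (α - 1)) with hK₂
  have hK₂0 : 0 ≤ K₂ := by positivity
  refine ⟨K₂ / (4 * C) + Ka * C ^ α + Ka * C ^ α + Ka * (Kb * C ^ β) ^ α +
    (K₁ + C) / 4 + Kc * B ^ (β / (β - 1)) + B, by positivity, ?_⟩
  intro s p τ G hs hp hτ hG hlow hp' hG'
  set Y : ℝ := 1 + τ ^ (α * β) with hY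
  have hτγ : 0 ≤ τ ^ (α * β) := by positivity
  have hY1 : 1 ≤ Y := by linarith
  have hτY (r : ℝ) (hr0 : 0 ≤ r) (hr : r ≤ α * β) : τ ^ r ≤ Y := by
    rcases le_total τ 1 with h | h
    · exact (Real.rpow_le_one hτ h hr0).trans hY1
    · exact (Real.rpow_le_rpow_of_exponent_le h hr).trans (by linarith)
  have hαβ : α ≤ α * β := by nlinarith
  have hsα : s ^ (α / (α - 1)) ≤ C * (s * G) + K₂ := by
    by_cases hz : z₀ ≤ s
    · have h1 := (div_le_iff₀ hC).1 (hlow hz)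
      have h2 : s ^ (α / (α - 1)) = s * s ^ (1 / (α - 1)) := by
        rw [← Real.rpow_one_add' hs (by positivity)]
        congr 1
        field_simp
        ring
      rw [h2]
      nlinarith
    · have h1 : s ^ (α / (α - 1)) ≤ K₂ :=
        Real.rpow_le_rpow hs ((not_le.1 hz).le.trans (le_abs_self _)) (by positivity)
      have : 0 ≤ C * (s * G) := by positivity
      linarith
  have hsα' : 1 / (12 * C) * s ^ (α / (α - 1)) ≤ s * G / 12 + K₂ / (12 * C) := by
    calc 1 / (12 * C) * s ^ (α / (α - 1)) ≤ 1 / (12 * C) * (C * (s * G) + K₂) := by gcongr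
      _ = s * G / 12 + K₂ / (12 * C) := by field_simp
  have t1 : C * s ≤ s * G / 12 + K₂ / (12 * C) + Ka * C ^ α := by
    have := ya s C hs hC.le
    linarith
  have t2 : s * (C * τ) ≤ s * G / 12 + K₂ / (12 * C) + Ka * C ^ α * Y := by
    have h1 := ya s (C * τ) hs (by positivity)
    rw [Real.mul_rpow hC.le hτ, ← mul_assoc] at h1
    have h2 : Ka * C ^ α * τ ^ α ≤ Ka * C ^ α * Y :=
      mul_le_mul_of_nonneg_left (hτY α (by linarith) hαβ) (by positivity)
    linarith
  have t3 : s * (p ^ (β - 1) * (C * τ)) ≤ s * p ^ β / C / 2 +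
      (s * G / 12 + K₂ / (12 * C) + Ka * (Kb * C ^ β) ^ α * Y) := by
    have h1 := yb (p ^ (β - 1)) (C * τ) (by positivity) (by positivity)
    rw [← Real.rpow_mul hp, mul_div_cancel₀ _ hβ1.ne', Real.mul_rpow hC.le hτ, ← mul_assoc] at h1
    have h2 := ya s (Kb * C ^ β * τ ^ β) hs (by positivity)
    rw [Real.mul_rpow (by positivity) (by positivity), ← Real.rpow_mul hτ, ← mul_assoc,
      mul_comm β α] at h2
    have h3 : Ka * (Kb * C ^ β) ^ α * τ ^ (α * β) ≤ Ka * (Kb * C ^ β) ^ α * Y :=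
      mul_le_mul_of_nonneg_left (by linarith) (by positivity)
    have h4 := mul_le_mul_of_nonneg_left h1 hs
    have h5 : s * (1 / (2 * C) * p ^ β + Kb * C ^ β * τ ^ β) =
        s * p ^ β / C / 2 + s * (Kb * C ^ β * τ ^ β) := by field_simp
    linarith
  have t4 : B * p ≤ s * G / 4 + (K₁ + C) / 4 + Kc * B ^ (β / (β - 1)) := by
    have h1 := yc p B hp hB
    have h2 : p ^ β / C ≤ s * G + K₁ + C := by linarith
    have h3 : 1 / (4 * C) * p ^ β = p ^ β / C / 4 := by field_simp
    linarith
  have t5 : B * τ ≤ B * Y := by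
    refine mul_le_mul_of_nonneg_left ?_ hB
    have := hτY 1 zero_le_one (by linarith)
    rwa [Real.rpow_one] at this
  have c1 : K₂ / (4 * C) ≤ K₂ / (4 * C) * Y := le_mul_of_one_le_right (by positivity) hY1
  have c2 : Ka * C ^ α ≤ Ka * C ^ α * Y := le_mul_of_one_le_right (by positivity) hY1
  have c3 : (K₁ + C) / 4 ≤ (K₁ + C) / 4 * Y := le_mul_of_one_le_right (by positivity) hY1
  have c4 : Kc * B ^ (β / (β - 1)) ≤ Kc * B ^ (β / (β - 1)) * Y :=
    le_mul_of_one_le_right (by positivity) hY1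
  have c0 : K₂ / (4 * C) = 3 * (K₂ / (12 * C)) := by field_simp; ring
  have e1 : s * (C * (p ^ (β - 1) + 1)) * τ = s * (p ^ (β - 1) * (C * τ)) + s * (C * τ) := by ring
  rw [e1]
  linarith

/-- For s ≥ 1 the factor s only helps; for s ≤ 1 monotonicity compares with `max 1 z₀`, where the
upper growth bound applies. This controls |Du|^β without the weight m. -/
theorem CouplingAssumption.le_mul_add {α C z₀ : ℝ} {g : ℝ → ℝ} (h : CouplingAssumption α C z₀ g)
    {s : ℝ} (hs : 0 ≤ s) : g s ≤ s * g s + C * (max 1 z₀ ^ (1 / (α - 1)) + 1) := by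
  have h0 : (0 : ℝ) ≤ max 1 z₀ := zero_le_one.trans (le_max_left _ _)
  have h1 := h.upper _ h0 (le_max_right _ _)
  have h2 := h.nonneg _ h0
  have h3 := h.nonneg _ hs
  rcases le_total s 1 with hs1 | hs1
  · have h4 : g s ≤ g (max 1 z₀) := h.monotoneOn hs h0 (hs1.trans (le_max_left _ _))
    nlinarith
  · nlinarith

/-- The integrand extends continuously to the compact closure; m ≥ 0 passes to the boundary, so `g`
is evaluated only where it is continuous. -/
theorem IsClassicalSolution.integrableOn_energy {d : ℕ} {Ω ΓD ΓN : Set (Space d)} (hΩ : IsOpen Ω)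
    (hb : Bornology.IsBounded Ω) {α β C z₀ : ℝ} (hβ : 0 ≤ β) {g : ℝ → ℝ}
    {H : Space d → Space d → ℝ} {j ψ m u : Space d → ℝ} (hg : CouplingAssumption α C z₀ g)
    (h : IsClassicalSolution Ω ΓD ΓN g H j ψ m u) :
    IntegrableOn (fun x => m x * g (m x) + (m x + 1) * ‖∇ u x‖ ^ β / C) Ω := by
  obtain ⟨P, hPc, hPu, -⟩ := h.boundary
  have hm0 : MapsTo m (closure Ω) (Ici 0) := fun x hx => by
    have := ((h.continuousOn_m x hx).mono subset_closure).mem_closure hx (t := Ici 0) h.nonneg_m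
    rwa [isClosed_Ici.closure_eq] at this
  have hc : ContinuousOn (fun x => m x * g (m x) + (m x + 1) * ‖P x‖ ^ β / C) (closure Ω) :=
    (h.continuousOn_m.mul (hg.contDiffOn.continuousOn.comp h.continuousOn_m hm0)).add
      (((h.continuousOn_m.add continuousOn_const).mul
        (hPc.norm.rpow_const fun _ _ => Or.inr hβ)).div_const C)
  refine (integrableOn_of_continuousOn_closure hb hc).congr_fun (fun x hx => ?_) hΩ.measurableSet
  simp only [hPu x hx]

end MFG

end

/-! ### The energy estimate. -/

/-- The energy identity, obtained by testing the transport equation with `u - ψ`, contains the boundary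
term `∫ j (u - ψ)` on `ΓN`. To bound it by `∫ |D(u - ψ)|` one needs a bounded solenoidal field on `Ω`
with normal component `j` on `ΓN` and nonpositive normal component on `ΓD`. Such a field depends only
on the data, and it exists as soon as the problem is solvable for some admissible `g` and `H`: it is
the flux of any one solution. The remaining terms are absorbed by Young's inequality. -/
theorem mainTheorem6 (d : ℕ) (hd : 0 < d) (Ω ΓD ΓN : Set (MFG.Space d))
    (hΩ : MFG.IsC1Domain Ω) (hΓ : MFG.IsBoundaryPartition Ω ΓD ΓN)
    (α β C z₀ : ℝ) (hα : 1 < α) (hβ : 1 < β) (hC : 0 < C)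
    (j : MFG.Space d → ℝ)
    (hj : MemLp j (ENNReal.ofReal (β / (β - 1))) ((MFG.surfaceMeasure d).restrict ΓN))
    (hj0 : ∀ᵐ x ∂(MFG.surfaceMeasure d).restrict ΓN, 0 ≤ j x)
    (ψ : MFG.Space d → ℝ) (hψc : ContinuousOn ψ (closure Ω)) (hψ : MFG.MemW1 Ω (α * β) ψ) :
    ∃ C₀ : ℝ, 0 < C₀ ∧
      ∀ (g : ℝ → ℝ) (H : MFG.Space d → MFG.Space d → ℝ),
        MFG.CouplingAssumption α C z₀ g → MFG.HamiltonianAssumption Ω β C H →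
        ∀ m u : MFG.Space d → ℝ, MFG.IsClassicalSolution Ω ΓD ΓN g H j ψ m u →
          IntegrableOn (fun x => m x * g (m x) + (m x + 1) * ‖∇ u x‖ ^ β / C) Ω ∧
          ∫ x in Ω, (m x * g (m x) + (m x + 1) * ‖∇ u x‖ ^ β / C) ≤ C₀ := by
  have hb := hΩ.isBounded
  have hfin : IsFiniteMeasure (volume.restrict Ω) := ⟨by simpa using hb.measure_lt_top⟩
  have hγ : 1 ≤ α * β := by nlinarith
  obtain ⟨-, W, hWp, hW⟩ := hψ
  have hWi : IntegrableOn W Ω := hWp.integrable (by simpa using hγ)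
  have hWγ : IntegrableOn (fun x => ‖W x‖ ^ (α * β)) Ω := by
    have := hWp.integrable_norm_rpow'
    rwa [ENNReal.toReal_ofReal (zero_le_one.trans hγ)] at this
  by_cases hex : ∃ (g : ℝ → ℝ) (H : MFG.Space d → MFG.Space d → ℝ) (m u : MFG.Space d → ℝ),
      MFG.CouplingAssumption α C z₀ g ∧ MFG.HamiltonianAssumption Ω β C H ∧
        MFG.IsClassicalSolution Ω ΓD ΓN g H j ψ m u
  swap
  · exact ⟨1, one_pos, fun g H hg hH m u h => (hex ⟨g, H, m, u, hg, hH, h⟩).elim⟩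
  obtain ⟨g', H', m', v, -, hH', h'⟩ := hex
  obtain ⟨-, G, -, -, -, hG⟩ := h'.exists_isFlux hΩ.isOpen hH'
  obtain ⟨B', hB'⟩ := hb.isCompact_closure.exists_bound_of_continuousOn hG.continuousOn
  set B := max B' 0 with hBdef
  have hGB (x) (hx : x ∈ Ω) : ‖G x‖ ≤ B := (hB' x (subset_closure hx)).trans (le_max_left _ _)
  set K₁ : ℝ := C * (max 1 z₀ ^ (1 / (α - 1)) + 1) with hK₁
  have hK₁0 : 0 ≤ K₁ := by
    have : (0 : ℝ) ≤ max 1 z₀ := zero_le_one.trans (le_max_left _ _)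
    positivity
  obtain ⟨K, hK0, hK⟩ := MFG.exists_pointwise_bound (z₀ := z₀) hα hβ hC (le_max_right B' 0) hK₁0
  have hint : IntegrableOn (fun x => 4 * K * (1 + ‖W x‖ ^ (α * β)) + (K₁ + C)) Ω :=
    (((integrable_const 1).add hWγ).const_mul (4 * K)).add (integrable_const _)
  have hint0 : 0 ≤ ∫ x in Ω, (4 * K * (1 + ‖W x‖ ^ (α * β)) + (K₁ + C)) :=
    integral_nonneg fun x => by positivity
  refine ⟨(∫ x in Ω, (4 * K * (1 + ‖W x‖ ^ (α * β)) + (K₁ + C))) + 1, by linarith, ?_⟩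
  intro g H hg hH m u h
  have hE := h.integrableOn_energy hΩ.isOpen hb (zero_le_one.trans hβ.le) hg
  refine ⟨hE, ?_⟩
  obtain ⟨P, F, hPc, hPu, hFeq, hF⟩ := h.exists_isFlux hΩ.isOpen hH
  obtain ⟨hI, hI0⟩ := hF.integral_inner_sub_le_zero hd hΩ hΓ hG hψc hW hWi h.continuousOn_u
    (h.contDiffOn_u.of_le (by norm_num)) hPc hPu
  -- Absorption leaves half of m|Du|^β/C + m g(m), and replacing |Du|^β/C by m g(m) + K₁ + C at most
  -- doubles this sum: hence the factor 4.
  have hpt (x) (hx : x ∈ Ω) : m x * g (m x) + (m x + 1) * ‖∇ u x‖ ^ β / C ≤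
      4 * inner ℝ (F x - G x) (∇ u x - W x) +
        (4 * K * (1 + ‖W x‖ ^ (α * β)) + (K₁ + C)) := by
    have hm := h.nonneg_m x hx
    have hHJ := h.hamiltonJacobi x hx
    have hlow := hH.lower x hx (∇ u x)
    have hlag := hH.lagrangian_lower x hx (∇ u x)
    have hDp := hH.bound_Dp x hx (∇ u x)
    rw [hHJ] at hlow hlag
    have hgle := hg.le_mul_add hm
    have hyoung := hK (m x) ‖∇ u x‖ ‖W x‖ (g (m x)) hm (norm_nonneg _) (norm_nonneg _)
      (hg.nonneg _ hm) (hg.lower _ hm) hlow hgle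
    have hFu : m x * (‖∇ u x‖ ^ β / C - C + g (m x)) ≤ inner ℝ (F x) (∇ u x) := by
      rw [hFeq x hx, real_inner_smul_left]
      exact mul_le_mul_of_nonneg_left (by linarith) hm
    have hFW : inner ℝ (F x) (W x) ≤ m x * (C * (‖∇ u x‖ ^ (β - 1) + 1)) * ‖W x‖ := by
      refine (real_inner_le_norm _ _).trans (mul_le_mul_of_nonneg_right ?_ (norm_nonneg _))
      rw [hFeq x hx, norm_smul, Real.norm_of_nonneg hm]
      exact mul_le_mul_of_nonneg_left hDp hm
    have hGu : inner ℝ (G x) (∇ u x) ≤ B * ‖∇ u x‖ :=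
      (real_inner_le_norm _ _).trans (mul_le_mul_of_nonneg_right (hGB x hx) (norm_nonneg _))
    have hGW : -(B * ‖W x‖) ≤ inner ℝ (G x) (W x) :=
      neg_le_of_abs_le ((abs_real_inner_le_norm _ _).trans
        (mul_le_mul_of_nonneg_right (hGB x hx) (norm_nonneg _)))
    have e1 : (inner ℝ (F x - G x) (∇ u x - W x) : ℝ) = inner ℝ (F x) (∇ u x) -
        inner ℝ (F x) (W x) - inner ℝ (G x) (∇ u x) + inner ℝ (G x) (W x) := by
      rw [inner_sub_left, inner_sub_right, inner_sub_right]
      ring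
    have e2 : m x * (‖∇ u x‖ ^ β / C - C + g (m x)) =
        m x * ‖∇ u x‖ ^ β / C + m x * g (m x) - C * m x := by ring
    have e3 : (m x + 1) * ‖∇ u x‖ ^ β / C = m x * ‖∇ u x‖ ^ β / C + ‖∇ u x‖ ^ β / C := by ring
    have hX : 0 ≤ m x * ‖∇ u x‖ ^ β / C := by positivity
    rw [e2] at hFu
    rw [e1, e3]
    linarith
  calc ∫ x in Ω, (m x * g (m x) + (m x + 1) * ‖∇ u x‖ ^ β / C)
      ≤ ∫ x in Ω, (4 * inner ℝ (F x - G x) (∇ u x - W x) +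
        (4 * K * (1 + ‖W x‖ ^ (α * β)) + (K₁ + C))) :=
        setIntegral_mono_on hE ((hI.const_mul 4).add hint) hΩ.isOpen.measurableSet hpt
    _ = 4 * (∫ x in Ω, (inner ℝ (F x - G x) (∇ u x - W x) : ℝ)) +
        ∫ x in Ω, (4 * K * (1 + ‖W x‖ ^ (α * β)) + (K₁ + C)) := by
        rw [integral_add (hI.const_mul 4) hint, integral_const_mul]
    _ ≤ _ := by linarith
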